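/- Let $k$ be a field of characteristic $0$ and $n\ge 0$. Let $\mathcal W=S_{n+1}$ be the Weyl group of type $A_n$ with simple reflections $s_i=(i,i+1)$, $1\le i\le n$, acting by permutation of coordinates on its geometric representation $V=\{x\in k^{n+1}:\sum_j x_j=0\}$. For a reflection (transposition) $t$ let $H_t\subset V$ be its fixed hyperplane. A Weyl line is a one-dimensional subspace of $V$ that is an intersection of a (possibly empty) family of hyperplanes $H_t$. Let $Z$ be the union of all Weyl lines, and let $V_i$ be the union of the Weyl lines not contained in $H_{s_i}$. For $X\subseteq V$ let $\mathcal O(X)$ be the algebra of regular (i.e. polynomial) functions on $X$, and put $\bar R=\mathcal O(Z)$, $R_i=\mathcal O(V_i)$. Define the $(\bar R,\bar R)$-bimodules $B_i=R_i\otimes_{R_i^{s_i}}R_i$. For an $(\bar R,\bar R)$-bimodule $B$ let $V_B^{\ell}$, $V_B^{r}\subseteq Z$ be the zero sets of its left and right annihilators in $\bar R$, and for two such bimodules put $$B\ast B'=B\otimes_{\bar R}\mathcal O(V_B^{r}\cap V_{B'}^{\ell})\otimes_{\bar R}B'.$$ An element $w\in\mathcal W$ is fully commutative if any two of its reduced expressions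 are related by a sequence of commutation relations $st=ts$ between simple reflections. For such $w$, $B_w$ denotes any bimodule isomorphic to $B_{i_1}\ast(B_{i_2}\ast(\cdots\ast B_{i_m}))$ for some reduced expression $w=s_{i_1}\cdots s_{i_m}$ (for $w=1$ the empty product is $\bar R$). Let $w\ne w'$ be fully commutative elements of $\mathcal W$. Then for any choice of the bimodules $B_w$ and $B_{w'}$, they are not isomorphic as (ungraded) $(\bar R,\bar R)$-bimodules. Moreover, if $n\ge 2$, then their pairs of annihilator varieties differ: $$(V_{B_w}^{\ell},V_{B_w}^{r})\ne(V_{B_{w'}}^{\ell},V_{B_{w'}}^{r}).$$ -/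

import Mathlib

noncomputable section

namespace TLBimod

open scoped TensorProduct

/-! ## Bimodules over commutative rings -/

/-- An `(A, B)`-bimodule for commutative rings `A` and `B`: an abelian group with an action of `A`
(the left operation) and a commuting action of `B` (the right operation). -/
structure Bimod (A B : Type*) [CommRing A] [CommRing B] where
  carrier : Type*
  [grp : AddCommGroup carrier]
  [left : Module A carrier]
  [right : Module B carrier]
  [comm : SMulCommClass B A carrier]

section Bimodules

attribute [local instance] Bimod.grp Bimod.left Bimod.right Bimod.comm

/-- An isomorphism of `(A, B)`-bimodules (gradings play no role). -/
structure Bimod.Iso {A B : Type*} [CommRing A] [CommRing B] (M N : Bimod A B) where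
  toEquiv : M.carrier ≃+ N.carrier
  map_left : ∀ (a : A) (m : M.carrier), toEquiv (a • m) = a • toEquiv m
  map_right : ∀ (b : B) (m : M.carrier), toEquiv (b • m) = b • toEquiv m

/-- The left annihilator of a bimodule. -/
def Bimod.leftAnn {A B : Type*} [CommRing A] [CommRing B] (M : Bimod A B) : Ideal A :=
  Module.annihilator A M.carrier

/-- The right annihilator of a bimodule. -/
def Bimod.rightAnn {A B : Type*} [CommRing A] [CommRing B] (M : Bimod A B) : Ideal B :=
  Module.annihilator B M.carrier

/-- A commutative ring `S` with ring morphisms `A → S` and `B → S`, seen as an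
`(A, B)`-bimodule. -/
def Bimod.ofRingHoms {A B S : Type*} [CommRing A] [CommRing B] [CommRing S]
    (f : A →+* S) (g : B →+* S) : Bimod A B :=
  letI : Module A S := Module.compHom S f
  letI : Module B S := Module.compHom S g
  haveI : SMulCommClass B A S := ⟨fun b a s => mul_left_comm (g b) (f a) s⟩
  { carrier := S }

/-- The action of `C` on `M ⊗[B] N` through the second factor, for a `(B, C)`-bimodule `N`:
`c • (m ⊗ x) = m ⊗ (c • x)`. -/
abbrev rightTensorModule {B C : Type*} [CommRing B] [CommRing C]
    (M : Type*) [AddCommGroup M] [Module B M]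
    (N : Type*) [AddCommGroup N] [Module B N] [Module C N] [SMulCommClass C B N] :
    Module C (M ⊗[B] N) :=
  Module.compHom (M ⊗[B] N)
    ((Module.End.lTensorAlgHom B N M).toRingHom.comp (Module.toModuleEnd B N (S := C)))

/-- The tensor product `M ⊗_B N` of an `(A, B)`-bimodule and a `(B, C)`-bimodule. In `M ⊗_B N` the
right operation of `B` on `M` is balanced against the left operation of `B` on `N`. -/
def Bimod.tensor {A B C : Type*} [CommRing A] [CommRing B] [CommRing C]
    (M : Bimod A B) (N : Bimod B C) : Bimod A C :=
  letI : Module A (M.carrier ⊗[B] N.carrier) := TensorProduct.leftModule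
  letI : Module C (M.carrier ⊗[B] N.carrier) := rightTensorModule M.carrier N.carrier
  haveI : SMulCommClass C A (M.carrier ⊗[B] N.carrier) :=
    ⟨fun c a x => by
      change (Module.toModuleEnd B N.carrier c).lTensor M.carrier (a • x)
        = a • (Module.toModuleEnd B N.carrier c).lTensor M.carrier x
      induction x using TensorProduct.induction_on with
      | zero => simp
      | tmul m y => simp [TensorProduct.smul_tmul']
      | add x y hx hy => rw [smul_add, map_add, map_add, smul_add, hx, hy]⟩
  { carrier := M.carrier ⊗[B] N.carrier }

end Bimodules

/-! ## Weyl lines in type `A_n`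

The Weyl group is `Equiv.Perm (Fin (n + 1))`, with simple reflections `s_i = (i, i+1)` for
`i : Fin n`; the reflections are the transpositions. -/

/-- The geometric representation: vectors in `k^(n+1)` with coordinate sum zero. -/
abbrev GeomRep (k : Type*) [Field k] (n : ℕ) : Submodule k (Fin (n + 1) → k) :=
  LinearMap.ker (∑ j, LinearMap.proj j : (Fin (n + 1) → k) →ₗ[k] k)

/-- The action of a permutation on the geometric representation, by permuting coordinates. -/
def act (k : Type*) [Field k] (n : ℕ) (w : Equiv.Perm (Fin (n + 1))) :
    GeomRep k n →ₗ[k] GeomRep k n :=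
  (LinearMap.funLeft k k (w⁻¹ : Equiv.Perm (Fin (n + 1)))).restrict (by
    intro v hv
    simp only [LinearMap.mem_ker, LinearMap.sum_apply, LinearMap.proj_apply,
      LinearMap.funLeft_apply] at hv ⊢
    exact (Equiv.sum_comp (w⁻¹ : Equiv.Perm (Fin (n + 1))) v).trans hv)

/-- The simple transposition `s_i`. -/
def simpleRefl {n : ℕ} (i : Fin n) : Equiv.Perm (Fin (n + 1)) :=
  Equiv.swap i.castSucc i.succ

/-- The hyperplane `H_t` of vectors fixed by the reflection `t`. -/
def hyperplane (k : Type*) [Field k] (n : ℕ) (t : Equiv.Perm (Fin (n + 1))) :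
    Submodule k (GeomRep k n) :=
  LinearMap.eqLocus (act k n t) LinearMap.id

/-- A Weyl line is a one-dimensional intersection of reflection hyperplanes. As usual, the
intersection of the empty family is the whole space (this only matters for `n = 1`). -/
def IsWeylLine {k : Type*} [Field k] {n : ℕ} (L : Submodule k (GeomRep k n)) : Prop :=
  Module.finrank k L = 1 ∧
    ∃ Q : Set (Equiv.Perm (Fin (n + 1))), (∀ t ∈ Q, t.IsSwap) ∧ L = ⨅ t ∈ Q, hyperplane k n t

/-- The union `Z` of all Weyl lines. -/
def weylUnion (k : Type*) [Field k] (n : ℕ) : Set (GeomRep k n) :=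
  {v | ∃ L : Submodule k (GeomRep k n), IsWeylLine L ∧ v ∈ L}

/-- The union `V_t` of the Weyl lines transverse to `t`, i.e. not contained in `H_t`. -/
def transverseUnion (k : Type*) [Field k] (n : ℕ) (t : Equiv.Perm (Fin (n + 1))) :
    Set (GeomRep k n) :=
  {v | ∃ L : Submodule k (GeomRep k n), IsWeylLine L ∧ ¬ L ≤ hyperplane k n t ∧ v ∈ L}

/-! ## Regular functions -/

/-- The algebra `O(X)` of regular functions on `X`: the functions `X → k` that are given by a
polynomial in the coordinates. -/
def regFun {k : Type*} [Field k] {n : ℕ} (X : Set (GeomRep k n)) : Subalgebra k (X → k) :=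
  (AlgHom.pi (fun x : X => MvPolynomial.aeval (R := k) (x.1 : Fin (n + 1) → k))).range

/-- Restriction of regular functions `O(X) → O(Y)` for `Y ⊆ X`. -/
def res {k : Type*} [Field k] {n : ℕ} {X Y : Set (GeomRep k n)} (h : Y ⊆ X) :
    regFun X →+* regFun Y where
  toFun f := ⟨fun y => f.1 ⟨y.1, h y.2⟩, by
    obtain ⟨_, p, rfl⟩ := f
    exact ⟨p, rfl⟩⟩
  map_one' := rfl
  map_mul' _ _ := rfl
  map_zero' := rfl
  map_add' _ _ := rfl

/-- The algebra `R̄` of regular functions on `Z`. -/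
abbrev Rbar (k : Type*) [Field k] (n : ℕ) : Type _ := regFun (weylUnion k n)

/-- The algebra `R_i` of regular functions on `V_i = V_{s_i}`. -/
abbrev Ri (k : Type*) [Field k] {n : ℕ} (i : Fin n) : Type _ :=
  regFun (transverseUnion k n (simpleRefl i))

/-- The subring of `s_i`-invariant regular functions on `V_i` (which is stable under `s_i`). -/
def invariants (k : Type*) [Field k] {n : ℕ} (i : Fin n) : Subring (Ri k i) where
  carrier := {f | ∀ x y : transverseUnion k n (simpleRefl i),
    y.1 = act k n (simpleRefl i) x.1 → f.1 y = f.1 x}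
  one_mem' _ _ _ := rfl
  zero_mem' _ _ _ := rfl
  mul_mem' hf hg x y h := congrArg₂ (· * ·) (hf x y h) (hg x y h)
  add_mem' hf hg x y h := congrArg₂ (· + ·) (hf x y h) (hg x y h)
  neg_mem' hf x y h := congrArg (- ·) (hf x y h)

theorem transverseUnion_subset (k : Type*) [Field k] (n : ℕ) (t : Equiv.Perm (Fin (n + 1))) :
    transverseUnion k n t ⊆ weylUnion k n :=
  fun _ ⟨L, hL, _, hv⟩ => ⟨L, hL, hv⟩

/-! ## The bimodules `B_i` and the `∗`-product -/

/-- The `(R̄, R̄)`-bimodule `B_i = R_i ⊗_{R_i^{s_i}} R_i`. -/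
def elemBimod (k : Type*) [Field k] {n : ℕ} (i : Fin n) : Bimod (Rbar k n) (Rbar k n) :=
  (Bimod.ofRingHoms (res (transverseUnion_subset k n (simpleRefl i)))
      (invariants k i).subtype).tensor
    (Bimod.ofRingHoms (invariants k i).subtype
      (res (transverseUnion_subset k n (simpleRefl i))))

/-- The closed subvariety of `Z` on which all functions in an ideal of `R̄` vanish. -/
def zeroSet {k : Type*} [Field k] {n : ℕ} (I : Ideal (Rbar k n)) : Set (GeomRep k n) :=
  {v | ∃ hv : v ∈ weylUnion k n, ∀ f ∈ I, f.1 ⟨v, hv⟩ = 0}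

/-- The variety `V_B^ℓ` of the left annihilator. -/
def leftVariety {k : Type*} [Field k] {n : ℕ} (B : Bimod (Rbar k n) (Rbar k n)) :
    Set (GeomRep k n) :=
  zeroSet B.leftAnn

/-- The variety `V_B^r` of the right annihilator. -/
def rightVariety {k : Type*} [Field k] {n : ℕ} (B : Bimod (Rbar k n) (Rbar k n)) :
    Set (GeomRep k n) :=
  zeroSet B.rightAnn

theorem inter_subset {k : Type*} [Field k] {n : ℕ} (B B' : Bimod (Rbar k n) (Rbar k n)) :
    rightVariety B ∩ leftVariety B' ⊆ weylUnion k n :=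
  fun _ hv => hv.1.1

/-- The product `B ∗ B' = B ⊗_{R̄} O(V_B^r ∩ V_{B'}^ℓ) ⊗_{R̄} B'`. -/
def star {k : Type*} [Field k] {n : ℕ} (B B' : Bimod (Rbar k n) (Rbar k n)) :
    Bimod (Rbar k n) (Rbar k n) :=
  (B.tensor (Bimod.ofRingHoms (res (inter_subset B B')) (res (inter_subset B B')))).tensor B'

/-- The bimodule of a sequence of indices: `B_{i_1 ⋯ i_m} = B_{i_1} ∗ (B_{i_2} ∗ (⋯ ∗ B_{i_m}))`,
and the bimodule of the empty sequence is `R̄`. -/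
def wordBimod (k : Type*) [Field k] (n : ℕ) : List (Fin n) → Bimod (Rbar k n) (Rbar k n)
  | [] => Bimod.ofRingHoms (RingHom.id (Rbar k n)) (RingHom.id (Rbar k n))
  | [i] => elemBimod k i
  | i :: j :: l => star (elemBimod k i) (wordBimod k n (j :: l))

/-! ## Fully commutative elements -/

/-- The product `s_{i_1} ⋯ s_{i_m}` of a sequence. -/
def wordProd {n : ℕ} (l : List (Fin n)) : Equiv.Perm (Fin (n + 1)) :=
  (l.map simpleRefl).prod

/-- `l` is a reduced expression of `w`: an expression of minimal length. -/
def IsReducedExpr {n : ℕ} (l : List (Fin n)) (w : Equiv.Perm (Fin (n + 1))) : Prop :=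
  wordProd l = w ∧ ∀ l' : List (Fin n), wordProd l' = w → l.length ≤ l'.length

/-- One application of a relation `s t = t s` between simple reflections inside a word. -/
def CommMove {n : ℕ} (l l' : List (Fin n)) : Prop :=
  ∃ (u v : List (Fin n)) (i j : Fin n), Commute (simpleRefl i) (simpleRefl j) ∧
    l = u ++ i :: j :: v ∧ l' = u ++ j :: i :: v

/-- `w` is fully commutative: one passes from any reduced expression to any other by applying only
commutation relations. -/
def IsFullyCommutative {n : ℕ} (w : Equiv.Perm (Fin (n + 1))) : Prop :=
  ∀ l l' : List (Fin n), IsReducedExpr l w → IsReducedExpr l' w →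
    Relation.ReflTransGen CommMove l l'

/-- `B` is a bimodule `B_w`: it is isomorphic to the `∗`-product of the `B_i` along some reduced
expression of `w`. -/
def IsBimodOf {k : Type*} [Field k] {n : ℕ} (w : Equiv.Perm (Fin (n + 1)))
    (B : Bimod (Rbar k n) (Rbar k n)) : Prop :=
  ∃ l : List (Fin n), IsReducedExpr l w ∧ Nonempty (B.Iso (wordBimod k n l))

end TLBimod

end

namespace TLBimod

open scoped TensorProduct

/-! ## Bimodules controlled by a relation between points -/

section Controlled

attribute [local instance] Bimod.grp Bimod.left Bimod.right Bimod.comm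

variable {k A B C X Y Z : Type*} [Field k] [CommRing A] [CommRing B] [CommRing C]

/-! A bimodule over rings of functions has a support, a relation between points of the left and of
the right space. A property stronger than being supported on a relation (`Bimod.Controlled`) is
chosen so that it passes to tensor products, where the relations compose
(`Bimod.Controlled.tensor`). It determines the relation from the isomorphism class, since related
pairs are exactly those carrying a point functional (`Bimod.Controlled.rel_iff`), and the
annihilator varieties are the domain and the range of the relation. For `B_i` the relation is "same
`s_i`-orbit inside `V_i`", and `∗` composes relations (`controlled_star`), so the bimodule of a word
has the composite of the relations of its letters.

Points on Weyl lines are scalar multiples of vectors attached to nonconstant two-colourings of the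
coordinates. On these vectors the letter `i` requires different colours at `i` and `i + 1`, and
exchanges them or not.

To recover `w` from this relation, note that one letter raises the sum of the positions coloured
`true` by at most one. A fully commutative `w` avoids the pattern 321, so some colouring separates
all inverted pairs. From it a reduced word attains the maximal gain, its length, by exchanging at
every letter. So the relation determines the length, and any word of that length attaining the gain
from the same colouring to the same end has the same product (`isRising_of_colourRel`,
`IsRising.eq_of_comp_eq`).

For the varieties, the relation of a word consists of the alternating colourings of its
Temperley–Lieb diagram (`colourRel_iff`), closed loops being dropped. With at least three positions,
the domain detects the arcs within the top row and the range those within the bottom row. A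
noncrossing matching is determined by these arcs (`IsNoncrossing.eq_of_rows`), so the two varieties
determine the whole relation. -/

/-- A functional on a bimodule on which both sides act through evaluation at a point. -/
def Bimod.IsPointFunctional (M : Bimod A B) (a : A →+* k) (b : B →+* k)
    (φ : M.carrier →+ k) : Prop :=
  φ ≠ 0 ∧ (∀ r m, φ (r • m) = a r * φ m) ∧ ∀ s m, φ (s • m) = b s * φ m

/-- `M` is supported, in a strong sense, on the relation `G` between the points `X` of `A` and the
points `Y` of `B`. -/
structure Bimod.Controlled (M : Bimod A B) (α : X → A →+* k) (β : Y → B →+* k)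
    (G : X → Y → Prop) : Prop where
  functional : ∀ x y, G x y → ∃ φ, M.IsPointFunctional (α x) (β y) φ
  -- If the zero set of `I` misses every point related to `y`, then `M / I M` dies after inverting
  -- some `b` with `b(y) ≠ 0`. Quantifying over all ideals, and not only `I = ⊥`, is what lets the
  -- condition pass to tensor products.
  right : ∀ (y : Y) (I : Ideal A), (∀ x, G x y → ∃ a ∈ I, α x a ≠ 0) →
    ∃ b, β y b ≠ 0 ∧ ∀ m : M.carrier, b • m ∈ (I • ⊤ : Submodule A M.carrier)
  left : ∀ (x : X) (J : Ideal B), (∀ y, G x y → ∃ b ∈ J, β y b ≠ 0) →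
    ∃ a, α x a ≠ 0 ∧ ∀ m : M.carrier, a • m ∈ (J • ⊤ : Submodule B M.carrier)

variable {α : X → A →+* k} {β : Y → B →+* k} {γ : Z → C →+* k}

theorem Bimod.controlled_ofRingHoms {S : Type*} [CommRing S] (f : A →+* S) (g : B →+* S)
    {G : X → Y → Prop}
    (hG : ∀ x y, G x y → ∃ θ : S →+* k, θ.comp f = α x ∧ θ.comp g = β y)
    (hr : ∀ (y : Y) (I : Ideal A), (∀ x, G x y → ∃ a ∈ I, α x a ≠ 0) →
      ∃ b, β y b ≠ 0 ∧ ∃ a ∈ I, ∃ s, g b = f a * s)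
    (hl : ∀ (x : X) (J : Ideal B), (∀ y, G x y → ∃ b ∈ J, β y b ≠ 0) →
      ∃ a, α x a ≠ 0 ∧ ∃ b ∈ J, ∃ s, f a = g b * s) :
    (Bimod.ofRingHoms f g).Controlled α β G where
  functional x y h := by
    obtain ⟨θ, hf, hg⟩ := hG x y h
    refine ⟨(θ : S →+ k), fun h0 => ?_, fun r m => ?_, fun s m => ?_⟩
    · have : θ 1 = 0 := DFunLike.congr_fun h0 (1 : S)
      simp at this
    · rw [← hf]; exact map_mul θ (f r) m
    · rw [← hg]; exact map_mul θ (g s) m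
  right y I h := by
    obtain ⟨b, hb, a, ha, s, e⟩ := hr y I h
    refine ⟨b, hb, fun m => ?_⟩
    let m₀ : S := m
    let m' : (Bimod.ofRingHoms f g).carrier := s * m₀
    have : b • m = a • m' := by
      change g b * m₀ = f a * (s * m₀)
      rw [e, mul_assoc]
    rw [this]
    exact Submodule.smul_mem_smul ha trivial
  left x J h := by
    obtain ⟨a, ha, b, hb, s, e⟩ := hl x J h
    refine ⟨a, ha, fun m => ?_⟩
    let m₀ : S := m
    let m' : (Bimod.ofRingHoms f g).carrier := s * m₀
    have : a • m = b • m' := by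
      change f a * m₀ = g b * (s * m₀)
      rw [e, mul_assoc]
    rw [this]
    exact Submodule.smul_mem_smul hb trivial

/-- The pure tensor in the tensor product of bimodules. -/
def Bimod.tmul (M : Bimod A B) (N : Bimod B C) (m : M.carrier) (x : N.carrier) :
    (M.tensor N).carrier :=
  m ⊗ₜ[B] x

section Tensor

variable (M : Bimod A B) (N : Bimod B C)

theorem Bimod.smul_left_tmul (a : A) (m : M.carrier) (x : N.carrier) :
    a • M.tmul N m x = M.tmul N (a • m) x := rfl

theorem Bimod.smul_right_tmul (c : C) (m : M.carrier) (x : N.carrier) :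
    c • M.tmul N m x = M.tmul N m (c • x) := rfl

theorem Bimod.smul_tmul (b : B) (m : M.carrier) (x : N.carrier) :
    M.tmul N (b • m) x = M.tmul N m (b • x) := TensorProduct.smul_tmul b m x

theorem Bimod.add_tmul (m m' : M.carrier) (x : N.carrier) :
    M.tmul N (m + m') x = M.tmul N m x + M.tmul N m' x := TensorProduct.add_tmul m m' x

theorem Bimod.tmul_add (m : M.carrier) (x x' : N.carrier) :
    M.tmul N m (x + x') = M.tmul N m x + M.tmul N m x' := TensorProduct.tmul_add m x x'

theorem Bimod.tensor_induction {p : (M.tensor N).carrier → Prop} (h0 : p 0)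
    (ht : ∀ m x, p (M.tmul N m x)) (ha : ∀ u v, p u → p v → p (u + v))
    (t : (M.tensor N).carrier) : p t :=
  TensorProduct.induction_on (motive := p) t h0 ht ha

end Tensor

variable {M : Bimod A B} {N : Bimod B C}

theorem Bimod.smul_right_tensor_mem {I : Ideal A} {I' : Ideal B} {c : C}
    (hI : ∀ b ∈ I', ∀ m : M.carrier, b • m ∈ (I • ⊤ : Submodule A M.carrier))
    (hc : ∀ x : N.carrier, c • x ∈ (I' • ⊤ : Submodule B N.carrier)) (t : (M.tensor N).carrier) :
    c • t ∈ (I • ⊤ : Submodule A (M.tensor N).carrier) := by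
  induction t using Bimod.tensor_induction with
  | h0 => rw [smul_zero]; exact zero_mem _
  | ha u v hu hv => rw [smul_add]; exact add_mem hu hv
  | ht m x =>
    rw [Bimod.smul_right_tmul]
    have hx := hc x
    generalize c • x = x at hx
    induction hx using Submodule.smul_induction_on' with
    | smul b hb x _ =>
      rw [← Bimod.smul_tmul]
      have hm := hI b hb m
      generalize b • m = m at hm
      induction hm using Submodule.smul_induction_on' with
      | smul a ha m _ =>
        rw [← Bimod.smul_left_tmul]
        exact Submodule.smul_mem_smul ha trivial
      | add u _ v _ hu hv => rw [Bimod.add_tmul]; exact add_mem hu hv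
    | add u _ v _ hu hv => rw [Bimod.tmul_add]; exact add_mem hu hv

theorem Bimod.smul_left_tensor_mem {J : Ideal C} {J' : Ideal B} {a : A}
    (hJ : ∀ b ∈ J', ∀ x : N.carrier, b • x ∈ (J • ⊤ : Submodule C N.carrier))
    (ha : ∀ m : M.carrier, a • m ∈ (J' • ⊤ : Submodule B M.carrier)) (t : (M.tensor N).carrier) :
    a • t ∈ (J • ⊤ : Submodule C (M.tensor N).carrier) := by
  induction t using Bimod.tensor_induction with
  | h0 => rw [smul_zero]; exact zero_mem _
  | ha u v hu hv => rw [smul_add]; exact add_mem hu hv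
  | ht m x =>
    rw [Bimod.smul_left_tmul]
    have hm := ha m
    generalize a • m = m at hm
    induction hm using Submodule.smul_induction_on' with
    | smul b hb m _ =>
      rw [Bimod.smul_tmul]
      have hx := hJ b hb x
      generalize b • x = x at hx
      induction hx using Submodule.smul_induction_on' with
      | smul c hc x _ =>
        rw [← Bimod.smul_right_tmul]
        exact Submodule.smul_mem_smul hc trivial
      | add u _ v _ hu hv => rw [Bimod.tmul_add]; exact add_mem hu hv
    | add u _ v _ hu hv => rw [Bimod.add_tmul]; exact add_mem hu hv

/-- The ideal of right multipliers carrying `M` into `I M`. -/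
def Bimod.rightTransporter (M : Bimod A B) (I : Ideal A) : Ideal B where
  carrier := {b | ∀ m : M.carrier, b • m ∈ (I • ⊤ : Submodule A M.carrier)}
  add_mem' h h' m := by rw [add_smul]; exact add_mem (h m) (h' m)
  zero_mem' m := by rw [zero_smul]; exact zero_mem _
  smul_mem' c b h m := by rw [smul_eq_mul, mul_comm, mul_smul]; exact h _

/-- The ideal of left multipliers carrying `M` into `M J`. -/
def Bimod.leftTransporter (M : Bimod A B) (J : Ideal B) : Ideal A where
  carrier := {a | ∀ m : M.carrier, a • m ∈ (J • ⊤ : Submodule B M.carrier)}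
  add_mem' h h' m := by rw [add_smul]; exact add_mem (h m) (h' m)
  zero_mem' m := by rw [zero_smul]; exact zero_mem _
  smul_mem' c b h m := by rw [smul_eq_mul, mul_comm, mul_smul]; exact h _

/-- The product of two point functionals is balanced because both evaluate at the same middle point.
For the support conditions, the ideal of middle scalars carrying `M` into `I M` is itself nonzero at
every relevant middle point, so the hypothesis on the other factor applies to it. -/
theorem Bimod.Controlled.tensor {G : X → Y → Prop} {H : Y → Z → Prop}
    (hM : M.Controlled α β G) (hN : N.Controlled β γ H) :
    (M.tensor N).Controlled α γ (Relation.Comp G H) where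
  functional x z := by
    rintro ⟨y, hxy, hyz⟩
    obtain ⟨φ, hφ, hφl, hφr⟩ := hM.functional x y hxy
    obtain ⟨ψ, hψ, hψl, hψr⟩ := hN.functional y z hyz
    let Φ : (M.tensor N).carrier →+ k :=
      TensorProduct.liftAddHom (R := B) ((AddMonoidHom.mul.compl₂ ψ).comp φ) (fun b m x => by
        change φ (b • m) * ψ x = φ m * ψ (b • x)
        rw [hφr, hψl]; ring)
    have hΦ : ∀ m x, Φ (M.tmul N m x) = φ m * ψ x := fun m x => rfl
    refine ⟨Φ, fun h0 => ?_, fun r t => ?_, fun s t => ?_⟩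
    · obtain ⟨m, hm⟩ := DFunLike.ne_iff.1 hφ
      obtain ⟨x, hx⟩ := DFunLike.ne_iff.1 hψ
      exact mul_ne_zero hm hx ((hΦ m x).symm.trans (DFunLike.congr_fun h0 _))
    · induction t using Bimod.tensor_induction with
      | h0 => simp
      | ha u v hu hv => rw [smul_add, map_add, map_add, hu, hv, mul_add]
      | ht m x => rw [Bimod.smul_left_tmul, hΦ, hΦ, hφl, mul_assoc]
    · induction t using Bimod.tensor_induction with
      | h0 => simp
      | ha u v hu hv => rw [smul_add, map_add, map_add, hu, hv, mul_add]
      | ht m x => rw [Bimod.smul_right_tmul, hΦ, hΦ, hψr, mul_left_comm]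
  right z I h := by
    obtain ⟨c, hc, hc'⟩ := hN.right z (M.rightTransporter I) fun y hyz => by
      obtain ⟨b, hb, hb'⟩ := hM.right y I fun x hxy => h x ⟨y, hxy, hyz⟩
      exact ⟨b, hb', hb⟩
    exact ⟨c, hc, Bimod.smul_right_tensor_mem (I' := M.rightTransporter I) (fun _ hb => hb) hc'⟩
  left x J h := by
    obtain ⟨a, ha, ha'⟩ := hM.left x (N.leftTransporter J) fun y hxy => by
      obtain ⟨b, hb, hb'⟩ := hN.left y J fun z hyz => h z ⟨y, hxy, hyz⟩
      exact ⟨b, hb', hb⟩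
    exact ⟨a, ha, Bimod.smul_left_tensor_mem (J' := N.leftTransporter J) (fun _ hb => hb) ha'⟩

theorem Bimod.Controlled.exists_left_iff {G : X → Y → Prop} (hM : M.Controlled α β G) (x : X) :
    (∃ y, G x y) ↔ ∀ a ∈ M.leftAnn, α x a = 0 := by
  constructor
  · rintro ⟨y, hxy⟩ a ha
    obtain ⟨φ, hφ, hl, -⟩ := hM.functional x y hxy
    obtain ⟨m, hm⟩ := DFunLike.ne_iff.1 hφ
    have := hl a m
    rw [Module.mem_annihilator.1 ha m, map_zero] at this
    exact (mul_eq_zero.1 this.symm).resolve_right hm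
  · intro h
    by_contra! hx
    -- With no related `y` the hypothesis is vacuous, so even the zero ideal is allowed and `a`
    -- annihilates `M`.
    obtain ⟨a, ha, ha'⟩ := hM.left x ⊥ fun y hy => absurd hy (hx y)
    exact ha (h a (Module.mem_annihilator.2 fun m => by simpa using ha' m))

theorem Bimod.Controlled.exists_right_iff {G : X → Y → Prop} (hM : M.Controlled α β G) (y : Y) :
    (∃ x, G x y) ↔ ∀ b ∈ M.rightAnn, β y b = 0 := by
  constructor
  · rintro ⟨x, hxy⟩ b hb
    obtain ⟨φ, hφ, -, hr⟩ := hM.functional x y hxy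
    obtain ⟨m, hm⟩ := DFunLike.ne_iff.1 hφ
    have := hr b m
    rw [Module.mem_annihilator.1 hb m, map_zero] at this
    exact (mul_eq_zero.1 this.symm).resolve_right hm
  · intro h
    by_contra! hx
    obtain ⟨b, hb, hb'⟩ := hM.right y ⊥ fun x hy => absurd hy (hx x)
    exact hb (h b (Module.mem_annihilator.2 fun m => by simpa using hb' m))

/-- If `x` and `y` are unrelated, the maximal ideal of `y` is nonzero at every point related to `x`.
Hence some `a` with `a(x) ≠ 0` maps `M` into a submodule killed by every point functional at `(x,
y)`. -/
theorem Bimod.Controlled.rel_iff {G : X → Y → Prop} (hM : M.Controlled α β G)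
    (hβ : ∀ y y', y' ≠ y → ∃ b, β y b = 0 ∧ β y' b ≠ 0) (x : X) (y : Y) :
    G x y ↔ ∃ φ, M.IsPointFunctional (α x) (β y) φ := by
  refine ⟨hM.functional x y, ?_⟩
  rintro ⟨φ, hφ, hl, hr⟩
  by_contra hG
  obtain ⟨a, ha, ha'⟩ := hM.left x (RingHom.ker (β y)) fun y' hy' => by
    obtain ⟨b, hb, hb'⟩ := hβ y y' (by rintro rfl; exact hG hy')
    exact ⟨b, hb, hb'⟩
  have key : ∀ m ∈ (RingHom.ker (β y) • ⊤ : Submodule B M.carrier), φ m = 0 := by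
    intro m hm
    induction hm using Submodule.smul_induction_on' with
    | smul b hb m _ => rw [hr, (RingHom.mem_ker).1 hb, zero_mul]
    | add u _ v _ hu hv => rw [map_add, hu, hv, add_zero]
  refine hφ (AddMonoidHom.ext fun m => ?_)
  have := hl a m
  rw [key _ (ha' m)] at this
  exact (mul_eq_zero.1 this.symm).resolve_left ha

end Controlled

/-! ### Invariance under isomorphism of bimodules -/

section Iso

attribute [local instance] Bimod.grp Bimod.left Bimod.right Bimod.comm

variable {k A B : Type*} [Field k] [CommRing A] [CommRing B]

theorem Bimod.Iso.leftAnn_eq {M N : Bimod A B} (e : M.Iso N) : M.leftAnn = N.leftAnn := by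
  ext a
  simp only [Bimod.leftAnn, Module.mem_annihilator]
  constructor
  · intro h m
    obtain ⟨m, rfl⟩ := e.toEquiv.surjective m
    rw [← e.map_left, h, map_zero]
  · intro h m
    apply e.toEquiv.injective
    rw [e.map_left, h, map_zero]

theorem Bimod.Iso.rightAnn_eq {M N : Bimod A B} (e : M.Iso N) : M.rightAnn = N.rightAnn := by
  ext a
  simp only [Bimod.rightAnn, Module.mem_annihilator]
  constructor
  · intro h m
    obtain ⟨m, rfl⟩ := e.toEquiv.surjective m
    rw [← e.map_right, h, map_zero]
  · intro h m
    apply e.toEquiv.injective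
    rw [e.map_right, h, map_zero]

theorem Bimod.Iso.exists_isPointFunctional {M N : Bimod A B} (e : M.Iso N) {a : A →+* k}
    {b : B →+* k} (h : ∃ φ, N.IsPointFunctional a b φ) : ∃ φ, M.IsPointFunctional a b φ := by
  obtain ⟨φ, hφ, hl, hr⟩ := h
  refine ⟨φ.comp e.toEquiv.toAddMonoidHom, fun h0 => hφ (AddMonoidHom.ext fun m => ?_),
    fun r m => ?_, fun s m => ?_⟩
  · obtain ⟨m, rfl⟩ := e.toEquiv.surjective m
    exact DFunLike.congr_fun h0 m
  · change φ (e.toEquiv _) = _ * φ (e.toEquiv _)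
    rw [e.map_left, hl]
  · change φ (e.toEquiv _) = _ * φ (e.toEquiv _)
    rw [e.map_right, hr]

/-- The inverse of a bimodule isomorphism. -/
def Bimod.Iso.symm {M N : Bimod A B} (e : M.Iso N) : N.Iso M where
  toEquiv := e.toEquiv.symm
  map_left a m := by rw [AddEquiv.symm_apply_eq, e.map_left, AddEquiv.apply_symm_apply]
  map_right a m := by rw [AddEquiv.symm_apply_eq, e.map_right, AddEquiv.apply_symm_apply]

/-- Composition of bimodule isomorphisms. -/
def Bimod.Iso.trans {A B : Type*} [CommRing A] [CommRing B] {M N P : Bimod A B} (e : M.Iso N)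
    (f : N.Iso P) : M.Iso P where
  toEquiv := e.toEquiv.trans f.toEquiv
  map_left a m := by
    rw [AddEquiv.trans_apply, e.map_left, f.map_left, AddEquiv.trans_apply]
  map_right a m := by
    rw [AddEquiv.trans_apply, e.map_right, f.map_right, AddEquiv.trans_apply]

theorem Bimod.Controlled.rel_iff_of_iso {X Y : Type*} {α : X → A →+* k} {β : Y → B →+* k}
    {M N : Bimod A B} {G H : X → Y → Prop} (hM : M.Controlled α β G) (hN : N.Controlled α β H)
    (hβ : ∀ y y', y' ≠ y → ∃ b, β y b = 0 ∧ β y' b ≠ 0) (e : M.Iso N) (x : X) (y : Y) :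
    G x y ↔ H x y := by
  rw [hM.rel_iff hβ, hN.rel_iff hβ]
  exact ⟨e.symm.exists_isPointFunctional, e.exists_isPointFunctional⟩

end Iso

/-! ## Weyl lines and two-colourings -/

section Colourings

variable {k : Type*} [Field k] {n : ℕ}

/-- The number of positions of a given colour. -/
def colourCount (c : Fin (n + 1) → Bool) (b : Bool) : ℕ := ∑ q, if c q = b then 1 else 0

theorem colourCount_pos {c : Fin (n + 1) → Bool} {b : Bool} {q : Fin (n + 1)} (h : c q = b) :
    0 < colourCount c b :=
  Finset.sum_pos' (fun _ _ => Nat.zero_le _) ⟨q, Finset.mem_univ _, by simp [h]⟩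

theorem colourCount_comp (c : Fin (n + 1) → Bool) (w : Equiv.Perm (Fin (n + 1))) (b : Bool) :
    colourCount (c ∘ w) b = colourCount c b :=
  Equiv.sum_comp w fun q => if c q = b then 1 else 0

variable (k) in
/-- The vector attached to a two-colouring of the coordinates; it spans the Weyl line on which
coordinates of the same colour agree. -/
def colourVec (c : Fin (n + 1) → Bool) : GeomRep k n :=
  ⟨fun p => if c p = true then (colourCount c false : k) else -(colourCount c true : k), by
    have h : ∀ p, (if c p = true then (colourCount c false : k) else -(colourCount c true : k)) =
        (if c p = true then (1 : k) else 0) * colourCount c false -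
          (if c p = false then (1 : k) else 0) * colourCount c true := by
      intro p; cases c p <;> simp
    simp only [LinearMap.mem_ker, LinearMap.sum_apply, LinearMap.proj_apply, h,
      Finset.sum_sub_distrib, ← Finset.sum_mul]
    simp only [colourCount, Nat.cast_sum, Nat.cast_ite, Nat.cast_one, Nat.cast_zero]
    ring⟩

theorem colourVec_apply (c : Fin (n + 1) → Bool) (p : Fin (n + 1)) :
    (colourVec k c).1 p =
      if c p = true then (colourCount c false : k) else -(colourCount c true : k) := rfl

theorem sum_coord_eq_zero (x : GeomRep k n) : ∑ p, x.1 p = 0 := by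
  have h := LinearMap.mem_ker.1 x.2
  rwa [LinearMap.sum_apply] at h

theorem act_apply (w : Equiv.Perm (Fin (n + 1))) (v : GeomRep k n) (p : Fin (n + 1)) :
    (act k n w v).1 p = v.1 (w⁻¹ p) := rfl

theorem act_colourVec (w : Equiv.Perm (Fin (n + 1))) (c : Fin (n + 1) → Bool) :
    act k n w (colourVec k c) = colourVec k (c ∘ (w⁻¹ : Equiv.Perm (Fin (n + 1)))) := by
  ext p
  rw [act_apply, colourVec_apply, colourVec_apply, colourCount_comp, colourCount_comp]
  rfl

theorem simpleRefl_inv (i : Fin n) : (simpleRefl i)⁻¹ = simpleRefl i := Equiv.swap_inv _ _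

theorem simpleRefl_mul_self (i : Fin n) : simpleRefl i * simpleRefl i = 1 :=
  Equiv.swap_mul_self _ _

@[simp] theorem simpleRefl_simpleRefl (i : Fin n) (p : Fin (n + 1)) :
    simpleRefl i (simpleRefl i p) = p := Equiv.swap_apply_self _ _ _

@[simp] theorem simpleRefl_castSucc (i : Fin n) : simpleRefl i i.castSucc = i.succ :=
  Equiv.swap_apply_left _ _

@[simp] theorem simpleRefl_succ (i : Fin n) : simpleRefl i i.succ = i.castSucc :=
  Equiv.swap_apply_right _ _

theorem act_simpleRefl_self (i : Fin n) (v : GeomRep k n) :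
    act k n (simpleRefl i) (act k n (simpleRefl i) v) = v := by
  ext p
  rw [act_apply, act_apply, simpleRefl_inv, simpleRefl_simpleRefl]

theorem mem_hyperplane_swap {p q : Fin (n + 1)} {v : GeomRep k n} :
    v ∈ hyperplane k n (Equiv.swap p q) ↔ v.1 p = v.1 q := by
  have : v ∈ hyperplane k n (Equiv.swap p q) ↔ act k n (Equiv.swap p q) v = v := Iff.rfl
  rw [this]
  constructor
  · intro h
    have := congrArg (fun u : GeomRep k n => u.1 q) h
    simpa [act_apply, -LinearMap.mem_ker] using this
  · intro h
    ext r
    rw [act_apply, Equiv.swap_inv]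
    rcases eq_or_ne r p with rfl | hp
    · rw [Equiv.swap_apply_left, h]
    · rcases eq_or_ne r q with rfl | hq
      · rw [Equiv.swap_apply_right, h]
      · rw [Equiv.swap_apply_of_ne_of_ne hp hq]

theorem mem_hyperplane_simpleRefl {i : Fin n} {v : GeomRep k n} :
    v ∈ hyperplane k n (simpleRefl i) ↔ v.1 i.castSucc = v.1 i.succ := mem_hyperplane_swap

variable [CharZero k]

theorem colourVec_apply_eq_iff (c : Fin (n + 1) → Bool) (p q : Fin (n + 1)) :
    (colourVec k c).1 p = (colourVec k c).1 q ↔ c p = c q := by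
  have key : ∀ p q, c p = true → c q = false → (colourVec k c).1 p ≠ (colourVec k c).1 q := by
    intro p q hp hq h
    rw [colourVec_apply, colourVec_apply, hp, hq, if_pos rfl, if_neg (by simp),
      eq_neg_iff_add_eq_zero] at h
    norm_cast at h
    have := colourCount_pos hp
    omega
  constructor
  · intro h
    by_contra hne
    cases hp : c p <;> cases hq : c q <;> simp only [hp, hq, not_true_eq_false] at hne
    · exact key q p hq hp h.symm
    · exact key p q hp hq h
  · intro h
    rw [colourVec_apply, colourVec_apply, h]

theorem colourVec_ne_zero {c : Fin (n + 1) → Bool} {p q : Fin (n + 1)} (h : c p ≠ c q) :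
    colourVec k c ≠ 0 := by
  intro h0
  refine h ((colourVec_apply_eq_iff (k := k) c p q).1 ?_)
  rw [h0]; rfl

/-- The sign of a coordinate recovers its colour; complementary colourings give opposite vectors on
the same line. Constant colourings must be excluded, as they all give zero. -/
theorem colourVec_injective {c c' : Fin (n + 1) → Bool} {p q : Fin (n + 1)} (h : c p ≠ c q)
    (e : colourVec k c = colourVec k c') : c = c' := by
  have key : ∀ (d d' : Fin (n + 1) → Bool) (r : Fin (n + 1)), (∃ s, d s = false) →
      d r = true → d' r = false → colourVec k d ≠ colourVec k d' := by
    intro d d' r ⟨s, hs⟩ hr hr' he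
    have := congrArg (fun u : GeomRep k n => u.1 r) he
    simp only [colourVec_apply, hr, hr', if_true, Bool.false_eq_true, if_false] at this
    rw [eq_neg_iff_add_eq_zero] at this
    norm_cast at this
    have := colourCount_pos hs
    omega
  have h' : c' p ≠ c' q := by
    rwa [Ne, ← colourVec_apply_eq_iff (k := k), ← e, colourVec_apply_eq_iff]
  have hex : ∀ d : Fin (n + 1) → Bool, d p ≠ d q → ∃ s, d s = false := by
    intro d hd
    cases hp : d p
    · exact ⟨p, hp⟩
    · exact ⟨q, by cases hq : d q <;> simp_all⟩
  ext r
  cases hr : c r <;> cases hr' : c' r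
  · rfl
  · exact absurd e.symm (key c' c r (hex _ h') hr' hr)
  · exact absurd e (key c c' r (hex _ h) hr hr')
  · rfl

theorem isWeylLine_span_colourVec {c : Fin (n + 1) → Bool} {a b : Fin (n + 1)} (h : c a ≠ c b) :
    IsWeylLine (Submodule.span k {colourVec k c}) := by
  wlog ha : c a = true generalizing a b
  · exact this h.symm (by cases hb : c b <;> simp_all)
  have hb : c b = false := by cases hb : c b <;> simp_all
  refine ⟨finrank_span_singleton (colourVec_ne_zero h),
    {t | ∃ p q, p ≠ q ∧ c p = c q ∧ t = Equiv.swap p q}, ?_, ?_⟩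
  · rintro t ⟨p, q, hpq, -, rfl⟩
    exact ⟨p, q, hpq, rfl⟩
  · apply le_antisymm
    · rw [Submodule.span_singleton_le_iff_mem, Submodule.mem_iInf]
      intro t
      rw [Submodule.mem_iInf]
      rintro ⟨p, q, -, hc, rfl⟩
      rw [mem_hyperplane_swap, colourVec_apply_eq_iff, hc]
    · intro x hx
      rw [Submodule.mem_iInf] at hx
      have hxc : ∀ p q, c p = c q → x.1 p = x.1 q := by
        intro p q hc
        rcases eq_or_ne p q with rfl | hpq
        · rfl
        · exact mem_hyperplane_swap.1
            ((Submodule.mem_iInf _).1 (hx (Equiv.swap p q)) ⟨p, q, hpq, hc, rfl⟩)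
      -- The coordinate sum, grouped by colour: `x` is constant on each colour class.
      have hsum : (colourCount c true : k) * x.1 a + colourCount c false * x.1 b = 0 := by
        have h0 : ∑ p, x.1 p = 0 := sum_coord_eq_zero x
        rw [← h0]
        simp only [colourCount, Nat.cast_sum, Nat.cast_ite, Nat.cast_one, Nat.cast_zero,
          Finset.sum_mul, ← Finset.sum_add_distrib]
        refine Finset.sum_congr rfl fun p _ => ?_
        cases hp : c p
        · simp [hxc p b (by rw [hp, hb])]
        · simp [hxc p a (by rw [hp, ha])]
      have hF : (colourCount c false : k) ≠ 0 := by
        exact_mod_cast (colourCount_pos hb).ne'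
      refine Submodule.mem_span_singleton.2 ⟨x.1 a / colourCount c false, ?_⟩
      ext p
      change x.1 a / colourCount c false * (colourVec k c).1 p = x.1 p
      rw [colourVec_apply]
      cases hp : c p
      · rw [hxc p b (by rw [hp, hb]), if_neg (by simp)]
        field_simp
        linear_combination (-1) * hsum
      · rw [hxc p a (by rw [hp, ha]), if_pos rfl]
        field_simp

theorem mem_transverseUnion_simpleRefl {i : Fin n} {x : GeomRep k n} :
    x ∈ transverseUnion k n (simpleRefl i) ↔
      ∃ (r : k) (c : Fin (n + 1) → Bool), c i.castSucc ≠ c i.succ ∧ x = r • colourVec k c := by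
  constructor
  · rintro ⟨L, ⟨hL, Q, hQ, rfl⟩, hLi, hx⟩
    by_cases hx0 : x = 0
    · refine ⟨0, fun p => decide (p = i.castSucc), ?_, by rw [hx0, zero_smul]⟩
      simp [Fin.ext_iff]
    · have hspan := (finrank_eq_one_iff_of_nonzero' (⟨x, hx⟩ : ↥(⨅ t ∈ Q, hyperplane k n t))
        (fun h => hx0 (congrArg Subtype.val h))).1 hL
      have hxi : x.1 i.castSucc ≠ x.1 i.succ := by
        intro h
        refine hLi fun z hz => ?_
        obtain ⟨r, hr⟩ := hspan ⟨z, hz⟩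
        have : z = r • x := congrArg Subtype.val hr.symm
        rw [this]
        exact Submodule.smul_mem _ _ (mem_hyperplane_simpleRefl.2 h)
      classical
      -- Every equality of coordinates of `x` is an equality of colours, so the colouring vector
      -- lies on the same line. That `x` takes only two values then follows from one-dimensionality.
      let c : Fin (n + 1) → Bool := fun p => decide (x.1 p = x.1 i.castSucc)
      have hci : c i.castSucc ≠ c i.succ := by simp [c, hxi.symm]
      have hc : colourVec k c ∈ ⨅ t ∈ Q, hyperplane k n t := by
        rw [Submodule.mem_iInf]; intro t
        rw [Submodule.mem_iInf]; intro ht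
        obtain ⟨p, q, -, rfl⟩ := hQ t ht
        have := mem_hyperplane_swap.1
          ((Submodule.mem_iInf _).1 ((Submodule.mem_iInf _).1 hx (Equiv.swap p q)) ht)
        rw [mem_hyperplane_swap, colourVec_apply_eq_iff]
        simp only [c, this]
      obtain ⟨r, hr⟩ := (finrank_eq_one_iff_of_nonzero' (⟨_, hc⟩ : ↥(⨅ t ∈ Q, hyperplane k n t))
        (fun h => colourVec_ne_zero hci (congrArg Subtype.val h))).1 hL ⟨x, hx⟩
      exact ⟨r, c, hci, congrArg Subtype.val hr.symm⟩
  · rintro ⟨r, c, hc, rfl⟩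
    refine ⟨_, isWeylLine_span_colourVec hc, fun h => hc ?_,
      Submodule.smul_mem _ _ (Submodule.mem_span_singleton_self _)⟩
    rw [← colourVec_apply_eq_iff (k := k)]
    exact mem_hyperplane_simpleRefl.1 (h (Submodule.mem_span_singleton_self _))

theorem colourVec_mem_weylUnion {c : Fin (n + 1) → Bool} {a b : Fin (n + 1)} (h : c a ≠ c b) :
    colourVec k c ∈ weylUnion k n :=
  ⟨_, isWeylLine_span_colourVec h, Submodule.mem_span_singleton_self _⟩

theorem colourVec_mem_transverseUnion {i : Fin n} {c : Fin (n + 1) → Bool} {a b : Fin (n + 1)}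
    (h : c a ≠ c b) :
    colourVec k c ∈ transverseUnion k n (simpleRefl i) ↔ c i.castSucc ≠ c i.succ := by
  refine ⟨fun hm => ?_, fun hc => mem_transverseUnion_simpleRefl.2 ⟨1, c, hc, (one_smul _ _).symm⟩⟩
  obtain ⟨r, d, hd, e⟩ := mem_transverseUnion_simpleRefl.1 hm
  have hr : r ≠ 0 := by
    rintro rfl
    exact colourVec_ne_zero h (by rw [e, zero_smul])
  rw [Ne, ← colourVec_apply_eq_iff (k := k), e]
  change ¬(r * (colourVec k d).1 _ = r * (colourVec k d).1 _)
  rw [mul_right_inj' hr, colourVec_apply_eq_iff]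
  exact hd

theorem act_mem_transverseUnion {i : Fin n} {x : GeomRep k n}
    (hx : x ∈ transverseUnion k n (simpleRefl i)) :
    act k n (simpleRefl i) x ∈ transverseUnion k n (simpleRefl i) := by
  obtain ⟨r, c, hc, rfl⟩ := mem_transverseUnion_simpleRefl.1 hx
  refine mem_transverseUnion_simpleRefl.2 ⟨r, c ∘ simpleRefl i, ?_, ?_⟩
  · simpa using hc.symm
  · rw [map_smul, act_colourVec, simpleRefl_inv]

end Colourings

/-! ## Regular functions -/

section RegularFunctions

variable {k : Type*} [Field k] {n : ℕ}

/-- Evaluation of a regular function at a point. -/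
noncomputable def evalAt {X : Set (GeomRep k n)} (x : X) : regFun X →+* k :=
  (Pi.evalRingHom (fun _ : X => k) x).comp (regFun X).val.toRingHom

theorem evalAt_res {X Y : Set (GeomRep k n)} (h : Y ⊆ X) (y : Y) :
    (evalAt y).comp (res h) = evalAt ⟨y.1, h y.2⟩ := rfl

/-- The regular function on `X` given by a polynomial. -/
noncomputable def regOf (X : Set (GeomRep k n)) (p : MvPolynomial (Fin (n + 1)) k) : regFun X :=
  ⟨fun x => MvPolynomial.aeval (x.1 : Fin (n + 1) → k) p, p, rfl⟩

theorem exists_regOf_eq {X : Set (GeomRep k n)} (f : regFun X) : ∃ p, regOf X p = f := by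
  obtain ⟨_, p, rfl⟩ := f
  exact ⟨p, rfl⟩

theorem evalAt_regOf {X : Set (GeomRep k n)} (x : X) (p : MvPolynomial (Fin (n + 1)) k) :
    evalAt x (regOf X p) = MvPolynomial.aeval (x.1 : Fin (n + 1) → k) p := rfl

theorem res_regOf {X Y : Set (GeomRep k n)} (h : Y ⊆ X) (p : MvPolynomial (Fin (n + 1)) k) :
    res h (regOf X p) = regOf Y p := rfl

theorem aeval_act (i : Fin n) (x : GeomRep k n) (p : MvPolynomial (Fin (n + 1)) k) :
    MvPolynomial.aeval ((act k n (simpleRefl i) x : GeomRep k n) : Fin (n + 1) → k) p =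
      MvPolynomial.aeval (x : Fin (n + 1) → k) (MvPolynomial.rename (simpleRefl i) p) := by
  rw [MvPolynomial.aeval_rename]
  congr 2

theorem evalAt_separates {X : Set (GeomRep k n)} (x y : X) (h : y ≠ x) :
    ∃ f : regFun X, evalAt x f = 0 ∧ evalAt y f ≠ 0 := by
  have : ∃ p, y.1.1 p ≠ x.1.1 p := by
    by_contra! h'
    exact h (Subtype.ext (Subtype.ext (funext h')))
  obtain ⟨p, hp⟩ := this
  refine ⟨regOf X (MvPolynomial.X p - MvPolynomial.C (x.1.1 p)), ?_, ?_⟩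
  · simp [evalAt_regOf]
  · simpa [evalAt_regOf, sub_eq_zero] using hp

variable [CharZero k]

/-- On `V_i` the coordinates `i` and `i + 1` show both colours, so every coordinate `j` equals one
of them and `(X_j - X_i)(X_j - X_{i+1})` vanishes. At a nonzero `y` with equal coordinates `i` and
`i + 1`, some `j` makes it nonzero, the coordinate sum being zero in characteristic zero. -/
theorem exists_res_eq_zero_of_notMem {i : Fin n} {y : weylUnion k n}
    (hy : y.1 ∉ transverseUnion k n (simpleRefl i)) :
    ∃ f : Rbar k n, res (transverseUnion_subset k n (simpleRefl i)) f = 0 ∧ evalAt y f ≠ 0 := by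
  obtain ⟨v, L, hL, hv⟩ := y
  have hle : L ≤ hyperplane k n (simpleRefl i) := by
    by_contra h
    exact hy ⟨L, hL, h, hv⟩
  have h1 : v.1 i.castSucc = v.1 i.succ := mem_hyperplane_simpleRefl.1 (hle hv)
  have h2 : ∃ j, v.1 j ≠ v.1 i.castSucc := by
    by_contra! h
    refine hy (mem_transverseUnion_simpleRefl.2
      ⟨0, fun p => decide (p = i.castSucc), by simp [Fin.ext_iff], ?_⟩)
    have h0 : ∑ p, v.1 p = 0 := sum_coord_eq_zero v
    simp only [h, Finset.sum_const, Finset.card_univ, Fintype.card_fin, nsmul_eq_mul] at h0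
    have h3 : v.1 i.castSucc = 0 :=
      (mul_eq_zero.1 h0).resolve_left (Nat.cast_ne_zero.2 (Nat.succ_ne_zero n))
    rw [zero_smul]
    ext p
    rw [h p, h3]; rfl
  obtain ⟨j, hj⟩ := h2
  refine ⟨regOf _ ((MvPolynomial.X j - MvPolynomial.X i.castSucc) *
    (MvPolynomial.X j - MvPolynomial.X i.succ)), ?_, ?_⟩
  · rw [res_regOf]
    apply Subtype.ext
    funext x
    obtain ⟨r, c, hc, hx⟩ := mem_transverseUnion_simpleRefl.1 x.2
    change MvPolynomial.aeval (x.1 : Fin (n + 1) → k) _ = 0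
    have hj : c j = c i.castSucc ∨ c j = c i.succ := by
      cases h : c j <;> cases h' : c i.castSucc <;> cases h'' : c i.succ <;> simp_all
    rw [hx]
    simp only [map_mul, map_sub, MvPolynomial.aeval_X]
    change (r * (colourVec k c).1 j - r * (colourVec k c).1 i.castSucc) *
      (r * (colourVec k c).1 j - r * (colourVec k c).1 i.succ) = 0
    rcases hj with hj | hj
    · rw [(colourVec_apply_eq_iff (k := k) c _ _).2 hj]; ring
    · rw [(colourVec_apply_eq_iff (k := k) c _ _).2 hj]; ring
  · rw [evalAt_regOf]
    simp only [map_mul, map_sub, MvPolynomial.aeval_X]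
    change (v.1 j - v.1 i.castSucc) * (v.1 j - v.1 i.succ) ≠ 0
    rw [← h1]
    exact mul_ne_zero (sub_ne_zero.2 hj) (sub_ne_zero.2 hj)

end RegularFunctions

/-! ## The relations attached to the bimodules of words -/

section Words

variable {k : Type*} [Field k] {n : ℕ}

variable (k) in
/-- The relation of the bimodule `B_i`: both points lie in `V_i` and in the same `s_i`-orbit. -/
def stepRel (i : Fin n) (x y : weylUnion k n) : Prop :=
  x.1 ∈ transverseUnion k n (simpleRefl i) ∧ (y.1 = x.1 ∨ y.1 = act k n (simpleRefl i) x.1)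

variable (k) in
/-- The relation of the bimodule of a word. -/
def wordRel : List (Fin n) → weylUnion k n → weylUnion k n → Prop
  | [] => Eq
  | i :: l => Relation.Comp (stepRel k i) (wordRel l)

theorem wordRel_singleton (i : Fin n) : wordRel k [i] = stepRel k i :=
  Relation.comp_eq

variable (k) in
/-- The `s_i`-orbit relation between points of `Z` and points of `V_i`. -/
def orbitRel (i : Fin n) (x : weylUnion k n) (y : transverseUnion k n (simpleRefl i)) : Prop :=
  y.1 = x.1 ∨ y.1 = act k n (simpleRefl i) x.1

theorem orbitRel_symm {i : Fin n} {x : weylUnion k n} {y : transverseUnion k n (simpleRefl i)}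
    (h : orbitRel k i x y) : x.1 = y.1 ∨ x.1 = act k n (simpleRefl i) y.1 := by
  rcases h with h | h
  · exact .inl h.symm
  · right; rw [h, act_simpleRefl_self]

/-- Evaluation of invariant functions at a point. -/
noncomputable def evalInv (i : Fin n) (y : transverseUnion k n (simpleRefl i)) : invariants k i →+* k :=
  (evalAt y).comp (invariants k i).subtype

/-- The hypothesis `hc` says that `W` is closed in the union of the Weyl lines. -/
theorem controlled_ofRingHoms_res {W : Set (GeomRep k n)} (hW : W ⊆ weylUnion k n)
    (hc : ∀ y : weylUnion k n, y.1 ∉ W → ∃ f, res hW f = 0 ∧ evalAt y f ≠ 0) :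
    (Bimod.ofRingHoms (res hW) (res hW)).Controlled evalAt evalAt
      (fun x y => x.1 ∈ W ∧ x = y) := by
  have key : ∀ (y : weylUnion k n) (I : Ideal (Rbar k n)),
      (y.1 ∈ W → ∃ f ∈ I, evalAt y f ≠ 0) →
      ∃ g, evalAt y g ≠ 0 ∧ ∃ f ∈ I, ∃ s, res hW g = res hW f * s := by
    intro y I h
    by_cases hy : y.1 ∈ W
    · obtain ⟨f, hf, hf'⟩ := h hy
      exact ⟨f, hf', f, hf, 1, (mul_one _).symm⟩
    · obtain ⟨f, hf, hf'⟩ := hc y hy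
      exact ⟨f, hf', 0, zero_mem _, 1, by rw [hf, map_zero, zero_mul]⟩
  refine Bimod.controlled_ofRingHoms _ _ ?_ (fun y I h => key y I fun hy => h y ⟨hy, rfl⟩)
    (fun x I h => key x I fun hx => h x ⟨hx, rfl⟩)
  rintro x _ ⟨hx, rfl⟩
  exact ⟨evalAt ⟨x.1, hx⟩, evalAt_res _ _, evalAt_res _ _⟩

theorem controlled_ofRingHoms_id :
    (Bimod.ofRingHoms (RingHom.id (Rbar k n)) (RingHom.id (Rbar k n))).Controlled
      evalAt evalAt Eq := by
  refine Bimod.controlled_ofRingHoms _ _ ?_ (fun y I h => ?_) (fun x I h => ?_)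
  · rintro x _ rfl
    exact ⟨evalAt x, rfl, rfl⟩
  · obtain ⟨f, hf, hf'⟩ := h y rfl
    exact ⟨f, hf', f, hf, 1, (mul_one _).symm⟩
  · obtain ⟨f, hf, hf'⟩ := h x rfl
    exact ⟨f, hf', f, hf, 1, (mul_one _).symm⟩

theorem mem_leftVariety_iff {B : Bimod (Rbar k n) (Rbar k n)}
    {G : weylUnion k n → weylUnion k n → Prop} (hB : B.Controlled evalAt evalAt G)
    (x : weylUnion k n) : x.1 ∈ leftVariety B ↔ ∃ y, G x y := by
  rw [hB.exists_left_iff]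
  exact ⟨fun h => h.2, fun h => ⟨x.2, h⟩⟩

theorem mem_rightVariety_iff {B : Bimod (Rbar k n) (Rbar k n)}
    {G : weylUnion k n → weylUnion k n → Prop} (hB : B.Controlled evalAt evalAt G)
    (y : weylUnion k n) : y.1 ∈ rightVariety B ↔ ∃ x, G x y := by
  rw [hB.exists_right_iff]
  exact ⟨fun h => h.2, fun h => ⟨y.2, h⟩⟩

theorem exists_res_eq_zero_of_notMem_zeroSet {W : Set (GeomRep k n)} {I : Ideal (Rbar k n)}
    (hI : W ⊆ zeroSet I) (hW : W ⊆ weylUnion k n) {y : weylUnion k n} (hy : y.1 ∉ zeroSet I) :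
    ∃ f, res hW f = 0 ∧ evalAt y f ≠ 0 := by
  have : ∃ f ∈ I, f.1 y ≠ 0 := by
    by_contra! h
    exact hy ⟨y.2, h⟩
  obtain ⟨f, hf, hf'⟩ := this
  refine ⟨f, Subtype.ext (funext fun x => ?_), hf'⟩
  exact (hI x.2).2 f hf

/-- The middle factor does not alter the composite: an intermediate point lies in the range of `G`
and in the domain of `G'`, hence in the intersection of the two varieties. -/
theorem controlled_star {B B' : Bimod (Rbar k n) (Rbar k n)}
    {G G' : weylUnion k n → weylUnion k n → Prop} (hB : B.Controlled evalAt evalAt G)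
    (hB' : B'.Controlled evalAt evalAt G') :
    (star B B').Controlled evalAt evalAt (Relation.Comp G G') := by
  have hmid := controlled_ofRingHoms_res (inter_subset B B') fun y hy => by
    by_cases h : y.1 ∈ rightVariety B
    · exact exists_res_eq_zero_of_notMem_zeroSet (I := B'.leftAnn) Set.inter_subset_right
        (inter_subset B B') fun h' => hy ⟨h, h'⟩
    · exact exists_res_eq_zero_of_notMem_zeroSet (I := B.rightAnn) Set.inter_subset_left
        (inter_subset B B') h
  have hcomp : Relation.Comp G G' = Relation.Comp (Relation.Comp G fun x y =>
      x.1 ∈ rightVariety B ∩ leftVariety B' ∧ x = y) G' := ?_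
  · rw [hcomp]
    exact (hB.tensor hmid).tensor hB'
  ext x z
  constructor
  · rintro ⟨y, hxy, hyz⟩
    exact ⟨y, ⟨y, hxy, ⟨(mem_rightVariety_iff hB y).2 ⟨x, hxy⟩,
      (mem_leftVariety_iff hB' y).2 ⟨z, hyz⟩⟩, rfl⟩, hyz⟩
  · rintro ⟨_, ⟨y, hxy, -, rfl⟩, hyz⟩
    exact ⟨y, hxy, hyz⟩

variable [CharZero k]

theorem mem_transverseUnion_of_orbitRel {i : Fin n} {x : weylUnion k n}
    {y : transverseUnion k n (simpleRefl i)} (h : orbitRel k i x y) :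
    x.1 ∈ transverseUnion k n (simpleRefl i) := by
  rcases orbitRel_symm h with h | h
  · rw [h]; exact y.2
  · rw [h]; exact act_mem_transverseUnion y.2

/-- Points of the invariant ring are indexed by `V_i` itself, so an orbit may be represented twice;
composing through them still gives exactly the orbit relation. -/
theorem comp_orbitRel (i : Fin n) :
    Relation.Comp (orbitRel k i) (flip (orbitRel k i)) = stepRel k i := by
  ext x z
  constructor
  · rintro ⟨y, hxy, hzy⟩
    refine ⟨mem_transverseUnion_of_orbitRel hxy, ?_⟩
    rcases hxy with h | h <;> rcases orbitRel_symm hzy with h' | h' <;> rw [h] at h'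
    · exact .inl h'
    · exact .inr h'
    · exact .inr h'
    · rw [act_simpleRefl_self] at h'
      exact .inl h'
  · rintro ⟨hx, h⟩
    refine ⟨⟨x.1, hx⟩, .inl rfl, ?_⟩
    rcases h with h | h
    · exact .inl h.symm
    · right; rw [h, act_simpleRefl_self]

theorem exists_eval_orbitRel {i : Fin n} {x : weylUnion k n}
    {y : transverseUnion k n (simpleRefl i)} (h : orbitRel k i x y) :
    ∃ θ : Ri k i →+* k, θ.comp (res (transverseUnion_subset k n (simpleRefl i))) = evalAt x ∧
      θ.comp (invariants k i).subtype = evalInv i y := by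
  refine ⟨evalAt ⟨x.1, mem_transverseUnion_of_orbitRel h⟩, evalAt_res _ _, ?_⟩
  ext f
  change f.1.1 _ = f.1.1 _
  rcases h with h | h
  · exact congrArg f.1.1 (Subtype.ext h.symm)
  · exact (f.2 _ _ h).symm

/-- A member of `I` nonzero at both points of the orbit is found among `a`, `b` and `a + b`; its
product with its `s_i`-translate is an invariant multiple. A polynomial lift makes the translate
available. -/
theorem exists_invariant_of_ideal {i : Fin n} (y : transverseUnion k n (simpleRefl i))
    (I : Ideal (Rbar k n)) (hI : ∀ x, orbitRel k i x y → ∃ f ∈ I, evalAt x f ≠ 0) :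
    ∃ g, evalInv i y g ≠ 0 ∧ ∃ f ∈ I, ∃ s, (invariants k i).subtype g =
      res (transverseUnion_subset k n (simpleRefl i)) f * s := by
  have hsub := transverseUnion_subset k n (simpleRefl i)
  let x₁ : weylUnion k n := ⟨y.1, hsub y.2⟩
  let x₂ : weylUnion k n := ⟨act k n (simpleRefl i) y.1, hsub (act_mem_transverseUnion y.2)⟩
  obtain ⟨f, hf, hf₁, hf₂⟩ : ∃ f ∈ I, evalAt x₁ f ≠ 0 ∧ evalAt x₂ f ≠ 0 := by
    obtain ⟨a, ha, ha'⟩ := hI x₁ (.inl rfl)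
    obtain ⟨b, hb, hb'⟩ := hI x₂ (.inr (act_simpleRefl_self _ _).symm)
    by_cases h₁ : evalAt x₂ a = 0
    · by_cases h₂ : evalAt x₁ b = 0
      · refine ⟨a + b, add_mem ha hb, ?_, ?_⟩
        · rwa [map_add, h₂, add_zero]
        · rwa [map_add, h₁, zero_add]
      · exact ⟨b, hb, h₂, hb'⟩
    · exact ⟨a, ha, ha', h₁⟩
  obtain ⟨p, rfl⟩ := exists_regOf_eq f
  have hinv : regOf (transverseUnion k n (simpleRefl i)) p *
      regOf _ (MvPolynomial.rename (simpleRefl i) p) ∈ invariants k i := by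
    intro u v huv
    change MvPolynomial.aeval (v.1 : Fin (n + 1) → k) _ * MvPolynomial.aeval (v.1 : Fin (n + 1) → k)
      _ = MvPolynomial.aeval (u.1 : Fin (n + 1) → k) _ * MvPolynomial.aeval (u.1 : Fin (n + 1) → k) _
    rw [← aeval_act, ← aeval_act, huv, act_simpleRefl_self, mul_comm]
  refine ⟨⟨_, hinv⟩, ?_, _, hf, _, rfl⟩
  change MvPolynomial.aeval (y.1 : Fin (n + 1) → k) _ *
    MvPolynomial.aeval (y.1 : Fin (n + 1) → k) _ ≠ 0
  rw [← aeval_act]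
  exact mul_ne_zero hf₁ hf₂

theorem exists_regular_of_ideal {i : Fin n} (x : weylUnion k n) (J : Ideal (invariants k i))
    (hJ : ∀ y, orbitRel k i x y → ∃ g ∈ J, evalInv i y g ≠ 0) :
    ∃ f, evalAt x f ≠ 0 ∧ ∃ g ∈ J, ∃ s,
      res (transverseUnion_subset k n (simpleRefl i)) f = (invariants k i).subtype g * s := by
  by_cases hx : x.1 ∈ transverseUnion k n (simpleRefl i)
  · obtain ⟨g, hg, hg'⟩ := hJ ⟨x.1, hx⟩ (.inl rfl)
    obtain ⟨p, hp⟩ := exists_regOf_eq ((invariants k i).subtype g)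
    refine ⟨regOf _ p, ?_, g, hg, 1, by rw [res_regOf, hp, mul_one]⟩
    change evalAt (⟨x.1, hx⟩ : transverseUnion k n (simpleRefl i)) _ ≠ 0 at hg'
    rwa [← hp] at hg'
  · obtain ⟨f, hf, hf'⟩ := exists_res_eq_zero_of_notMem hx
    exact ⟨f, hf', 0, zero_mem _, 1, by rw [hf, map_zero, zero_mul]⟩

theorem controlled_elemBimod (i : Fin n) :
    (elemBimod k i).Controlled evalAt evalAt (stepRel k i) := by
  rw [← comp_orbitRel]
  exact Bimod.Controlled.tensor (β := evalInv i)
    (Bimod.controlled_ofRingHoms _ _ (fun _ _ h => exists_eval_orbitRel h)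
      exists_invariant_of_ideal exists_regular_of_ideal)
    (Bimod.controlled_ofRingHoms _ _
      (fun _ _ h => (exists_eval_orbitRel h).imp fun _ => And.symm)
      exists_regular_of_ideal exists_invariant_of_ideal)

theorem controlled_wordBimod (l : List (Fin n)) :
    (wordBimod k n l).Controlled evalAt evalAt (wordRel k l) := by
  induction l with
  | nil => exact controlled_ofRingHoms_id
  | cons i l ih =>
    cases l with
    | nil => rw [wordRel_singleton]; exact controlled_elemBimod i
    | cons j l => exact controlled_star (controlled_elemBimod i) ih

end Words

/-! ## Inversions and reduced expressions -/

section Inversions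

variable {n : ℕ}

/-- The number of inversions of `w⁻¹`. -/
def invCount (w : Equiv.Perm (Fin (n + 1))) : ℕ :=
  (Finset.univ.filter fun x : Fin (n + 1) × Fin (n + 1) => x.1 < x.2 ∧ w⁻¹ x.2 < w⁻¹ x.1).card

theorem simpleRefl_lt_simpleRefl {i : Fin n} {p q : Fin (n + 1)} (h : p < q)
    (hne : ¬(p = i.castSucc ∧ q = i.succ)) : simpleRefl i p < simpleRefl i q := by
  simp only [Fin.ext_iff, Fin.val_castSucc, Fin.val_succ, Fin.lt_def] at h hne
  simp only [simpleRefl, Equiv.swap_apply_def, Fin.lt_def, Fin.ext_iff]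
  split_ifs <;> simp_all <;> omega

theorem simpleRefl_mul_inv_apply (i : Fin n) (w : Equiv.Perm (Fin (n + 1))) (p : Fin (n + 1)) :
    (simpleRefl i * w)⁻¹ p = w⁻¹ (simpleRefl i p) := by
  rw [mul_inv_rev, simpleRefl_inv, Equiv.Perm.mul_apply]

theorem simpleRefl_mul_cancel (i : Fin n) (w : Equiv.Perm (Fin (n + 1))) :
    simpleRefl i * (simpleRefl i * w) = w := by
  rw [← mul_assoc, simpleRefl_mul_self, one_mul]

/-- The inversions on the new side are the `s_i`-images of the old ones together with the pair `(i,
i + 1)`. -/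
theorem invCount_simpleRefl_mul {i : Fin n} {w : Equiv.Perm (Fin (n + 1))}
    (h : w⁻¹ i.castSucc < w⁻¹ i.succ) : invCount (simpleRefl i * w) = invCount w + 1 := by
  have hlt : i.castSucc < i.succ := Fin.castSucc_lt_succ
  have himg : (Finset.univ.filter fun x : Fin (n + 1) × Fin (n + 1) =>
      x.1 < x.2 ∧ (simpleRefl i * w)⁻¹ x.2 < (simpleRefl i * w)⁻¹ x.1) =
      insert (i.castSucc, i.succ) ((Finset.univ.filter fun x : Fin (n + 1) × Fin (n + 1) =>
        x.1 < x.2 ∧ w⁻¹ x.2 < w⁻¹ x.1).image (Prod.map (simpleRefl i) (simpleRefl i))) := by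
    ext ⟨p, q⟩
    simp only [Finset.mem_filter, Finset.mem_univ, true_and, Finset.mem_insert, Finset.mem_image,
      Prod.mk.injEq, Prod.exists, Prod.map, simpleRefl_mul_inv_apply]
    constructor
    · rintro ⟨hpq, hw⟩
      by_cases hi : p = i.castSucc ∧ q = i.succ
      · exact .inl hi
      · exact .inr ⟨_, _, ⟨simpleRefl_lt_simpleRefl hpq hi, hw⟩, by simp, by simp⟩
    · rintro (⟨rfl, rfl⟩ | ⟨p, q, ⟨hpq, hw⟩, rfl, rfl⟩)
      · rw [simpleRefl_castSucc, simpleRefl_succ]; exact ⟨hlt, h⟩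
      · refine ⟨simpleRefl_lt_simpleRefl hpq ?_, by
          rwa [simpleRefl_simpleRefl, simpleRefl_simpleRefl]⟩
        rintro ⟨rfl, rfl⟩
        exact absurd hw h.asymm
  rw [invCount, himg, Finset.card_insert_of_notMem, Finset.card_image_of_injective]
  · rfl
  · exact (simpleRefl i).injective.prodMap (simpleRefl i).injective
  · simp only [Finset.mem_image, Finset.mem_filter, Finset.mem_univ, true_and, Prod.exists,
      Prod.map, Prod.mk.injEq, not_exists, not_and]
    intro p q hpq hp hq
    have hp' : p = i.succ := by rw [← simpleRefl_simpleRefl i p, hp, simpleRefl_castSucc]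
    have hq' : q = i.castSucc := by rw [← simpleRefl_simpleRefl i q, hq, simpleRefl_succ]
    rw [hp', hq'] at hpq
    exact absurd hpq.1 hlt.asymm

theorem invCount_of_descent {i : Fin n} {w : Equiv.Perm (Fin (n + 1))}
    (h : w⁻¹ i.succ < w⁻¹ i.castSucc) : invCount w = invCount (simpleRefl i * w) + 1 := by
  rw [← invCount_simpleRefl_mul, simpleRefl_mul_cancel]
  rwa [simpleRefl_mul_inv_apply, simpleRefl_mul_inv_apply, simpleRefl_castSucc, simpleRefl_succ]

theorem invCount_wordProd_le (l : List (Fin n)) : invCount (wordProd l) ≤ l.length := by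
  induction l with
  | nil =>
    refine le_of_eq ?_
    change (Finset.univ.filter _).card = 0
    rw [Finset.card_eq_zero, Finset.filter_eq_empty_iff]
    rintro ⟨p, q⟩ - ⟨h, h'⟩
    exact absurd h' h.asymm
  | cons i l ih =>
    have hw : wordProd (i :: l) = simpleRefl i * wordProd l := by simp [wordProd]
    rw [hw, List.length_cons]
    rcases lt_trichotomy ((wordProd l)⁻¹ i.castSucc) ((wordProd l)⁻¹ i.succ) with h | h | h
    · rw [invCount_simpleRefl_mul h]; omega
    · exact absurd ((wordProd l)⁻¹.injective h) Fin.castSucc_lt_succ.ne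
    · have := invCount_of_descent h
      omega

theorem exists_wordProd_eq (w : Equiv.Perm (Fin (n + 1))) :
    ∃ l, wordProd l = w ∧ l.length = invCount w := by
  induction hm : invCount w generalizing w with
  | zero =>
    refine ⟨[], ?_, rfl⟩
    have hmono : StrictMono (w⁻¹ : Equiv.Perm (Fin (n + 1))) := Fin.strictMono_iff_lt_succ.2 fun i => by
      rcases lt_trichotomy (w⁻¹ i.castSucc) (w⁻¹ i.succ) with h | h | h
      · exact h
      · exact absurd (w⁻¹.injective h) Fin.castSucc_lt_succ.ne
      · have := invCount_of_descent h
        omega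
    -- A finite chain has no order automorphism but the identity.
    have h1 : w⁻¹ = 1 := Equiv.ext fun p => DFunLike.congr_fun (Subsingleton.elim
      (hmono.orderIsoOfSurjective _ (w⁻¹ : Equiv.Perm (Fin (n + 1))).surjective)
      (OrderIso.refl _)) p
    rw [← inv_inv w, h1]; rfl
  | succ m ih =>
    by_cases hd : ∃ i : Fin n, w⁻¹ i.succ < w⁻¹ i.castSucc
    · obtain ⟨i, hi⟩ := hd
      obtain ⟨l, hl, hl'⟩ := ih (simpleRefl i * w) (by have := invCount_of_descent hi; omega)
      refine ⟨i :: l, ?_, by rw [List.length_cons, hl']⟩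
      rw [wordProd, List.map_cons, List.prod_cons]
      change simpleRefl i * wordProd l = w
      rw [hl, simpleRefl_mul_cancel]
    · exfalso
      have hmono : StrictMono (w⁻¹ : Equiv.Perm (Fin (n + 1))) := Fin.strictMono_iff_lt_succ.2 fun i => by
        rcases lt_trichotomy (w⁻¹ i.castSucc) (w⁻¹ i.succ) with h | h | h
        · exact h
        · exact absurd (w⁻¹.injective h) Fin.castSucc_lt_succ.ne
        · exact absurd ⟨i, h⟩ hd
      have : invCount w = 0 := by
        rw [invCount, Finset.card_eq_zero, Finset.filter_eq_empty_iff]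
        rintro ⟨p, q⟩ - ⟨h, h'⟩
        exact absurd h' (hmono h).asymm
      omega

theorem isReducedExpr_iff {l : List (Fin n)} {w : Equiv.Perm (Fin (n + 1))} :
    IsReducedExpr l w ↔ wordProd l = w ∧ l.length = invCount w := by
  constructor
  · rintro ⟨rfl, h⟩
    obtain ⟨l', hl', hlen⟩ := exists_wordProd_eq (wordProd l)
    exact ⟨rfl, le_antisymm ((h l' hl').trans hlen.le) (invCount_wordProd_le l)⟩
  · rintro ⟨rfl, h⟩
    refine ⟨rfl, fun l' hl' => ?_⟩
    rw [h, ← hl']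
    exact invCount_wordProd_le l'

theorem wordProd_cons (i : Fin n) (l : List (Fin n)) :
    wordProd (i :: l) = simpleRefl i * wordProd l := by simp [wordProd]

theorem IsReducedExpr.of_cons {i : Fin n} {l : List (Fin n)} {w : Equiv.Perm (Fin (n + 1))}
    (h : IsReducedExpr (i :: l) w) :
    w⁻¹ i.succ < w⁻¹ i.castSucc ∧ IsReducedExpr l (simpleRefl i * w) := by
  rw [isReducedExpr_iff, List.length_cons, wordProd_cons] at h
  obtain ⟨rfl, h⟩ := h
  rw [simpleRefl_mul_cancel, isReducedExpr_iff]
  have hle := invCount_wordProd_le l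
  rcases lt_trichotomy ((wordProd l)⁻¹ i.castSucc) ((wordProd l)⁻¹ i.succ) with h' | h' | h'
  · rw [invCount_simpleRefl_mul h'] at h
    simp only [simpleRefl_mul_inv_apply, simpleRefl_castSucc, simpleRefl_succ]
    exact ⟨h', trivial, by omega⟩
  · exact absurd ((wordProd l)⁻¹.injective h') Fin.castSucc_lt_succ.ne
  · have := invCount_of_descent h'
    omega

theorem isReducedExpr_cons {i : Fin n} {l : List (Fin n)} {w : Equiv.Perm (Fin (n + 1))}
    (hi : w⁻¹ i.succ < w⁻¹ i.castSucc) (h : IsReducedExpr l (simpleRefl i * w)) :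
    IsReducedExpr (i :: l) w := by
  rw [isReducedExpr_iff] at h ⊢
  rw [wordProd_cons, h.1, simpleRefl_mul_cancel, List.length_cons, h.2, invCount_of_descent hi]
  exact ⟨rfl, rfl⟩

end Inversions

/-! ## Fully commutative elements avoid the pattern `321` -/

section PatternAvoidance

variable {n : ℕ}

theorem CommMove.perm {l l' : List (Fin n)} (h : CommMove l l') : l.Perm l' := by
  obtain ⟨u, v, i, j, -, rfl, rfl⟩ := h
  exact (List.Perm.swap _ _ _).append_left u

theorem IsFullyCommutative.perm {w : Equiv.Perm (Fin (n + 1))} (hw : IsFullyCommutative w)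
    {l l' : List (Fin n)} (hl : IsReducedExpr l w) (hl' : IsReducedExpr l' w) : l.Perm l' := by
  have h := hw l l' hl hl'
  clear hl'
  induction h with
  | refl => exact .refl _
  | tail _ h ih => exact ih.trans h.perm

theorem exists_descent_between {w : Equiv.Perm (Fin (n + 1))} {a b : Fin (n + 1)} (hab : a < b)
    (hw : w⁻¹ b < w⁻¹ a) :
    ∃ i : Fin n, a ≤ i.castSucc ∧ i.succ ≤ b ∧ w⁻¹ i.succ < w⁻¹ i.castSucc := by
  by_contra! h
  have key : ∀ p : Fin (n + 1), a ≤ p → p ≤ b → w⁻¹ a ≤ w⁻¹ p := by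
    intro p
    induction p using Fin.induction with
    | zero =>
      intro h0 _
      rw [Fin.le_zero_iff.1 h0]
    | succ i ih =>
      intro h1 h2
      rcases h1.eq_or_lt with h1 | h1
      · rw [h1]
      · have h3 : a ≤ i.castSucc := Fin.le_castSucc_iff.2 h1
        exact (ih h3 (Fin.castSucc_lt_succ.le.trans h2)).trans (h i h3 h2)
  exact absurd hw (key b hab.le le_rfl).not_gt

theorem braid_relation {i j : Fin n} (h : i.succ = j.castSucc) :
    simpleRefl i * (simpleRefl j * simpleRefl i) =
      simpleRefl j * (simpleRefl i * simpleRefl j) := by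
  have h1 : i.castSucc ≠ i.succ := Fin.castSucc_lt_succ.ne
  have h2 : j.succ ≠ i.succ := by rw [h]; exact Fin.castSucc_lt_succ.ne'
  have h3 : j.succ ≠ i.castSucc := by
    have : i.castSucc < j.succ := Fin.castSucc_lt_succ.trans (h ▸ Fin.castSucc_lt_succ)
    exact this.ne'
  have e1 := Equiv.swap_mul_swap_mul_swap h1 h3.symm
  have e2 := Equiv.swap_mul_swap_mul_swap h2 h3
  simp only [simpleRefl, ← h]
  rw [Equiv.swap_comm j.succ i.succ] at e2
  rw [← mul_assoc, ← mul_assoc, Equiv.swap_comm i.castSucc i.succ, e2,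
    Equiv.swap_comm i.succ i.castSucc, e1, Equiv.swap_comm]

/-- Descents are stripped off while the 321 pattern survives. In the end its three positions are
consecutive, and the two sides of the braid relation start reduced words with different letter
counts, which commutations cannot change. -/
theorem exists_reduced_not_perm {w : Equiv.Perm (Fin (n + 1))} {a b c : Fin (n + 1)}
    (hab : a < b) (hbc : b < c) (hwab : w⁻¹ b < w⁻¹ a) (hwbc : w⁻¹ c < w⁻¹ b) :
    ∃ l l', IsReducedExpr l w ∧ IsReducedExpr l' w ∧ ¬ l.Perm l' := by
  induction hm : invCount w using Nat.strong_induction_on generalizing w a b c with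
  | _ m ih =>
  subst hm
  have step : ∀ i : Fin n, w⁻¹ i.succ < w⁻¹ i.castSucc → ¬(a = i.castSucc ∧ b = i.succ) →
      ¬(b = i.castSucc ∧ c = i.succ) →
      ∃ l l', IsReducedExpr l w ∧ IsReducedExpr l' w ∧ ¬ l.Perm l' := by
    intro i hi h1 h2
    obtain ⟨l, l', hl, hl', hp⟩ := ih _ (by rw [invCount_of_descent hi]; exact Nat.lt_succ_self _)
      (w := simpleRefl i * w) (simpleRefl_lt_simpleRefl hab h1) (simpleRefl_lt_simpleRefl hbc h2)
      (by simpa only [simpleRefl_mul_inv_apply, simpleRefl_simpleRefl] using hwab)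
      (by simpa only [simpleRefl_mul_inv_apply, simpleRefl_simpleRefl] using hwbc) rfl
    exact ⟨i :: l, i :: l', isReducedExpr_cons hi hl, isReducedExpr_cons hi hl',
      fun h => hp (List.perm_cons i |>.1 h)⟩
  obtain ⟨i, hai, hib, hi⟩ := exists_descent_between hab hwab
  obtain ⟨j, hbj, hjc, hj⟩ := exists_descent_between hbc hwbc
  by_cases h1 : a = i.castSucc ∧ b = i.succ
  swap
  · refine step i hi h1 fun h => ?_
    rw [h.1] at hib
    exact absurd hib Fin.castSucc_lt_succ.not_ge
  by_cases h2 : b = j.castSucc ∧ c = j.succ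
  swap
  · refine step j hj (fun h => ?_) h2
    rw [h.2] at hbj
    exact absurd hbj Fin.castSucc_lt_succ.not_ge
  obtain ⟨rfl, rfl⟩ := h1
  obtain ⟨hij, rfl⟩ := h2
  have hne : i ≠ j := by
    rintro rfl
    exact absurd hij Fin.castSucc_lt_succ.ne'
  have e1 : simpleRefl i j.succ = j.succ :=
    Equiv.swap_apply_of_ne_of_ne (hab.trans hbc).ne' hbc.ne'
  have e2 : simpleRefl j i.castSucc = i.castSucc :=
    Equiv.swap_apply_of_ne_of_ne (hij ▸ hab.ne) (hab.trans hbc).ne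
  have d1 : (simpleRefl i * w)⁻¹ j.succ < (simpleRefl i * w)⁻¹ j.castSucc := by
    rw [simpleRefl_mul_inv_apply, simpleRefl_mul_inv_apply, e1, ← hij, simpleRefl_succ]
    exact hwbc.trans hwab
  have d2 : (simpleRefl j * (simpleRefl i * w))⁻¹ i.succ <
      (simpleRefl j * (simpleRefl i * w))⁻¹ i.castSucc := by
    simp only [simpleRefl_mul_inv_apply]
    rw [e2, simpleRefl_castSucc, hij, simpleRefl_castSucc, e1, ← hij]
    exact hwbc
  obtain ⟨l, hl, hlen⟩ := exists_wordProd_eq (simpleRefl i * (simpleRefl j * (simpleRefl i * w)))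
  have hl₁ : IsReducedExpr (i :: j :: i :: l) w := isReducedExpr_cons hi (isReducedExpr_cons d1
    (isReducedExpr_cons d2 (isReducedExpr_iff.2 ⟨hl, hlen⟩)))
  have hl₂ : IsReducedExpr (j :: i :: j :: l) w := by
    rw [isReducedExpr_iff] at hl₁ ⊢
    refine ⟨?_, hl₁.2⟩
    rw [← hl₁.1]
    simp only [wordProd_cons]
    have := congrArg (· * wordProd l) (braid_relation hij)
    simp only [mul_assoc] at this
    exact this.symm
  refine ⟨_, _, hl₁, hl₂, fun h => ?_⟩
  have := h.count_eq i
  simp [hne.symm] at this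

theorem IsFullyCommutative.not_pattern {w : Equiv.Perm (Fin (n + 1))} (hw : IsFullyCommutative w)
    {a b c : Fin (n + 1)} (hab : a < b) (hbc : b < c) (hwab : w⁻¹ b < w⁻¹ a) :
    ¬ w⁻¹ c < w⁻¹ b := by
  intro hwbc
  obtain ⟨l, l', hl, hl', hp⟩ := exists_reduced_not_perm hab hbc hwab hwbc
  exact hp (hw.perm hl hl')

end PatternAvoidance

/-! ## Colourings moved by words -/

section ColourRel

variable {n : ℕ}

/-- One step of a word on colourings: the colours at `i` and `i + 1` differ, and they may be
exchanged. -/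
def colourStep (i : Fin n) (c c' : Fin (n + 1) → Bool) : Prop :=
  c i.castSucc ≠ c i.succ ∧ (c' = c ∨ c' = c ∘ simpleRefl i)

/-- The relation of a word on colourings. -/
def colourRel : List (Fin n) → (Fin (n + 1) → Bool) → (Fin (n + 1) → Bool) → Prop
  | [] => Eq
  | i :: l => Relation.Comp (colourStep i) (colourRel l)

/-- The sum of the positions coloured `true`. -/
def moment (c : Fin (n + 1) → Bool) : ℤ := ∑ p, if c p = true then (p.val : ℤ) else 0

theorem moment_comp_simpleRefl (i : Fin n) (c : Fin (n + 1) → Bool) :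
    moment (c ∘ simpleRefl i) = moment c + (if c i.castSucc = true then 1 else 0) -
      (if c i.succ = true then 1 else 0) := by
  have h : ∀ p : Fin (n + 1), ((simpleRefl i p).val : ℤ) = p.val +
      (if p = i.castSucc then 1 else 0) - (if p = i.succ then 1 else 0) := by
    intro p
    simp only [simpleRefl, Equiv.swap_apply_def]
    have : i.castSucc ≠ i.succ := Fin.castSucc_lt_succ.ne
    split_ifs <;> simp_all
  have h1 : moment (c ∘ simpleRefl i) =
      ∑ p, if c p = true then ((simpleRefl i p).val : ℤ) else 0 := by
    rw [moment, ← Equiv.sum_comp (simpleRefl i)]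
    simp
  rw [h1, moment]
  have h2 : ∀ p : Fin (n + 1), (if c p = true then ((simpleRefl i p).val : ℤ) else 0) =
      (if c p = true then (p.val : ℤ) else 0) +
      (if p = i.castSucc then (if c p = true then 1 else 0) else 0) -
      (if p = i.succ then (if c p = true then 1 else 0) else 0) := by
    intro p; rw [h]; split_ifs <;> simp
  simp only [h2, Finset.sum_sub_distrib, Finset.sum_add_distrib, Finset.sum_ite_eq',
    Finset.mem_univ, if_true]

/-- The colouring separates inverted pairs, with the left position coloured `true`. -/
def IsRising (w : Equiv.Perm (Fin (n + 1))) (c : Fin (n + 1) → Bool) : Prop :=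
  ∀ p q, p < q → w⁻¹ q < w⁻¹ p → c p = true ∧ c q = false

/-- Positions that are the left end of an inversion are coloured `true`. A right end that is also a
left end would produce a 321 pattern. -/
theorem IsFullyCommutative.exists_isRising {w : Equiv.Perm (Fin (n + 1))}
    (hw : IsFullyCommutative w) : ∃ c, IsRising w c := by
  classical
  refine ⟨fun p => decide (∃ q, p < q ∧ w⁻¹ q < w⁻¹ p), fun p q hpq h => ⟨?_, ?_⟩⟩
  · exact decide_eq_true ⟨q, hpq, h⟩
  · refine decide_eq_false ?_
    rintro ⟨r, hqr, hr⟩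
    exact hw.not_pattern hpq hqr h hr

theorem moment_step_le {i : Fin n} {c c' : Fin (n + 1) → Bool} (h : colourStep i c c') :
    moment c' ≤ moment c + 1 := by
  rcases h with ⟨-, rfl | rfl⟩
  · omega
  · rw [moment_comp_simpleRefl]
    split_ifs <;> omega

theorem moment_le_of_colourRel {l : List (Fin n)} {c c' : Fin (n + 1) → Bool}
    (h : colourRel l c c') : moment c' ≤ moment c + l.length := by
  induction l generalizing c with
  | nil => cases h; simp
  | cons i l ih =>
    obtain ⟨d, h1, h2⟩ := h
    have := ih h2
    have := moment_step_le h1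
    push_cast [List.length_cons]
    omega

/-- Maximal total gain forces gain one at each letter: a genuine exchange with `true` on the left.
-/
theorem isRising_of_colourRel {l : List (Fin n)} {c c' : Fin (n + 1) → Bool}
    (h : colourRel l c c') (hm : moment c' = moment c + l.length) :
    IsRising (wordProd l) c ∧ c' = c ∘ wordProd l := by
  induction l generalizing c with
  | nil =>
    cases h
    refine ⟨fun p q hpq hqp => ?_, rfl⟩
    exact absurd (show q < p from hqp) hpq.asymm
  | cons i l ih =>
    obtain ⟨d, h1, h2⟩ := h
    have hle := moment_le_of_colourRel h2
    have hle' := moment_step_le h1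
    push_cast [List.length_cons] at hm
    obtain ⟨hr, rfl⟩ := ih h2 (by omega)
    obtain ⟨hne, rfl | rfl⟩ := h1
    · omega
    · rw [moment_comp_simpleRefl] at hle hle'
      rw [wordProd_cons]
      have hc : c i.castSucc = true ∧ c i.succ = false := by
        cases h1 : c i.castSucc <;> cases h2 : c i.succ <;> simp [h1, h2] at hne hle ⊢
        omega
      refine ⟨fun p q hpq hw => ?_, rfl⟩
      rw [simpleRefl_mul_inv_apply, simpleRefl_mul_inv_apply] at hw
      by_cases hi : p = i.castSucc ∧ q = i.succ
      · rw [hi.1, hi.2]; exact hc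
      · have := hr _ _ (simpleRefl_lt_simpleRefl hpq hi) hw
        simpa using this

theorem IsReducedExpr.colourRel_of_isRising {l : List (Fin n)} {w : Equiv.Perm (Fin (n + 1))}
    {c : Fin (n + 1) → Bool} (hl : IsReducedExpr l w) (hc : IsRising w c) :
    colourRel l c (c ∘ w) ∧ moment (c ∘ w) = moment c + l.length := by
  induction l generalizing w c with
  | nil =>
    have : w = 1 := hl.1.symm
    subst this
    exact ⟨rfl, by simp⟩
  | cons i l ih =>
    obtain ⟨hi, hl'⟩ := hl.of_cons
    have hci := hc _ _ Fin.castSucc_lt_succ hi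
    have hrise : IsRising (simpleRefl i * w) (c ∘ simpleRefl i) := by
      intro p q hpq h
      rw [simpleRefl_mul_inv_apply, simpleRefl_mul_inv_apply] at h
      refine hc _ _ (simpleRefl_lt_simpleRefl hpq ?_) h
      rintro ⟨rfl, rfl⟩
      rw [simpleRefl_castSucc, simpleRefl_succ] at h
      exact absurd h hi.asymm
    obtain ⟨h1, h2⟩ := ih hl' hrise
    have hcomp : (c ∘ simpleRefl i) ∘ (simpleRefl i * w : Equiv.Perm (Fin (n + 1))) = c ∘ w := by
      ext p; simp
    rw [hcomp] at h1 h2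
    refine ⟨⟨_, ⟨by simp [hci], .inr rfl⟩, h1⟩, ?_⟩
    rw [h2, moment_comp_simpleRefl, hci.1, hci.2]
    push_cast [List.length_cons]
    simp
    ring

/-- Inverted pairs have different colours, so `w⁻¹` is increasing on each colour class, and `c ∘ w`
prescribes the image of that class. An increasing bijection between given finite sets is unique. -/
theorem IsRising.eq_of_comp_eq {w w' : Equiv.Perm (Fin (n + 1))} {c : Fin (n + 1) → Bool}
    (h : IsRising w c) (h' : IsRising w' c) (e : c ∘ w = c ∘ w') : w = w' := by
  have key : ∀ (u v : Equiv.Perm (Fin (n + 1))), IsRising v c → c ∘ u = c ∘ v →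
      ∀ p, (∀ q < p, u⁻¹ q = v⁻¹ q) → v⁻¹ p ≤ u⁻¹ p := by
    intro u v hv e p hp
    let q := v (u⁻¹ p)
    have hq : v⁻¹ q = u⁻¹ p := Equiv.symm_apply_apply v _
    have hcq : c q = c p := by
      have := congrFun e (u⁻¹ p)
      simpa [q] using this.symm
    rcases lt_trichotomy q p with hlt | heq | hlt
    · have := hp q hlt
      rw [hq] at this
      exact absurd (u⁻¹.injective this) hlt.ne
    · rw [← hq, heq]
    · rw [← hq]
      by_contra hgt
      have := hv p q hlt (not_le.1 hgt)
      rw [hcq, this.1] at this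
      exact absurd this.2 (by simp)
  have hinv : ∀ p, w⁻¹ p = w'⁻¹ p := by
    intro p
    induction p using WellFoundedLT.induction with
    | ind p ih =>
      exact le_antisymm (key w' w h e.symm p fun q hq => (ih q hq).symm) (key w w' h' e p ih)
  exact inv_injective (Equiv.ext hinv)

theorem length_le_of_colourRel {w : Equiv.Perm (Fin (n + 1))} {l l' : List (Fin n)}
    (hw : IsFullyCommutative w) (hl : IsReducedExpr l w)
    (h : ∀ c c', (∃ p q, c p ≠ c q) → colourRel l c c' → colourRel l' c c') :
    l.length ≤ l'.length := by
  obtain ⟨c, hc⟩ := hw.exists_isRising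
  obtain ⟨h1, h2⟩ := hl.colourRel_of_isRising hc
  -- The relation is compared only on nonconstant colourings. For a nonempty word the first letter
  -- guarantees this; for the empty word the rising colouring may be constant.
  cases l with
  | nil => exact Nat.zero_le _
  | cons i l =>
    have hne := h1.choose_spec.1.1
    have := moment_le_of_colourRel (h _ _ ⟨_, _, hne⟩ h1)
    omega

theorem IsFullyCommutative.eq_of_colourRel {w w' : Equiv.Perm (Fin (n + 1))}
    {l l' : List (Fin n)} (hw : IsFullyCommutative w) (hw' : IsFullyCommutative w')
    (hl : IsReducedExpr l w) (hl' : IsReducedExpr l' w')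
    (h : ∀ c c', (∃ p q, c p ≠ c q) → (colourRel l c c' ↔ colourRel l' c c')) : w = w' := by
  have hlen : l.length = l'.length := le_antisymm
    (length_le_of_colourRel hw hl fun c c' hc => (h c c' hc).1)
    (length_le_of_colourRel hw' hl' fun c c' hc => (h c c' hc).2)
  obtain ⟨c, hc⟩ := hw.exists_isRising
  obtain ⟨h1, h2⟩ := hl.colourRel_of_isRising hc
  cases l with
  | nil =>
    rw [List.eq_nil_of_length_eq_zero hlen.symm] at hl'
    exact hl.1.symm.trans hl'.1
  | cons i l =>
    obtain ⟨hr, e⟩ := isRising_of_colourRel ((h _ _ ⟨_, _, h1.choose_spec.1.1⟩).1 h1)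
      (by rw [h2, hlen])
    rw [hl'.1] at hr e
    exact hc.eq_of_comp_eq hr e

end ColourRel

/-! ## Noncrossing matchings -/

section Matchings

variable {P : Type*}

/-- A fixed-point-free involution. -/
def IsMatching (σ : P → P) : Prop := ∀ p, σ (σ p) = p ∧ σ p ≠ p

/-- No two arcs of the matching cross, for the order of the points given by `pos`. -/
def IsNoncrossing (pos : P → ℕ) (σ : P → P) : Prop :=
  ∀ p u, pos p < pos u → pos u < pos (σ p) → pos p < pos (σ u) ∧ pos (σ u) < pos (σ p)

/-- The two ends of each arc have different colours. -/
def IsAlternating (σ : P → P) (z : P → Bool) : Prop := ∀ p, z (σ p) = !z p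

/-- Join the points `a` and `b` by an arc, and join their former partners. -/
def rewire [DecidableEq P] (a b : P) (σ : P → P) (p : P) : P :=
  if p = a then b else if p = b then a else
    if σ p = a then σ b else if σ p = b then σ a else σ p

variable [DecidableEq P] {a b : P} {σ : P → P}

theorem IsMatching.rewire (h : IsMatching σ) (hab : a ≠ b) : IsMatching (rewire a b σ) := by
  have h1 : ∀ p, σ (σ p) = p := fun p => (h p).1
  have h2 : ∀ p, σ p ≠ p := fun p => (h p).2
  intro p
  unfold TLBimod.rewire
  grind

theorem IsNoncrossing.rewire {pos : P → ℕ} (hpos : Function.Injective pos) (h : IsMatching σ)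
    (hn : IsNoncrossing pos σ) (hab : pos b = pos a + 1) :
    IsNoncrossing pos (rewire a b σ) := by
  have h1 : ∀ p, σ (σ p) = p := fun p => (h p).1
  have h2 : ∀ p, σ p ≠ p := fun p => (h p).2
  have h3 : ∀ p q, pos p = pos q → p = q := fun p q e => hpos e
  have h4 : ∀ p u, pos p < pos u → pos u < pos (σ p) →
    pos p < pos (σ u) ∧ pos (σ u) < pos (σ p) := hn
  intro p u hpu hup
  have hba : b ≠ a := fun e => by rw [e] at hab; omega
  by_cases p1 : p = a
  · simp only [TLBimod.rewire, p1, if_true] at hpu hup; omega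
  by_cases p2 : p = b
  · simp only [TLBimod.rewire, p2, hba, if_true, if_false] at hpu hup; omega
  have n1 : ∀ u, u ≠ a → u ≠ b → pos u < pos a ∨ pos b < pos u := fun u hu hu' => by
    have : pos u ≠ pos a := fun e => hu (hpos e)
    have : pos u ≠ pos b := fun e => hu' (hpos e)
    omega
  by_cases p3 : σ p = a
  · simp only [TLBimod.rewire, p1, p2, p3, if_true, if_false] at hup ⊢
    have : p = σ a := by rw [← p3, h1]
    grind
  by_cases p4 : σ p = b
  · simp only [TLBimod.rewire, p1, p2, p4, hba, if_true, if_false] at hup ⊢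
    have : p = σ b := by rw [← p4, h1]
    grind
  simp only [TLBimod.rewire, p1, p2, p3, p4, if_false] at hup ⊢
  grind

/-- This is stacking a cup-cap diagram on the matching: `z'` colours the erased middle points, which
must differ, and agrees with `z` elsewhere. -/
theorem isAlternating_rewire_iff (h : IsMatching σ) (hab : a ≠ b) (z : P → Bool) :
    IsAlternating (rewire a b σ) z ↔ z a ≠ z b ∧
      ∃ z', z' a ≠ z' b ∧ (∀ p, p ≠ a → p ≠ b → z' p = z p) ∧ IsAlternating σ z' := by
  have h1 : ∀ p, σ (σ p) = p := fun p => (h p).1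
  have h2 : ∀ p, σ p ≠ p := fun p => (h p).2
  constructor
  · intro hz
    have ha := hz a
    have hσa := hz (σ a)
    unfold TLBimod.rewire at ha hσa
    refine ⟨by simp at ha; simp [ha], fun p => if p = a then !z (σ a) else if p = b then !z (σ b)
      else z p, ?_, ?_, ?_⟩
    · grind
    · grind
    · intro p
      have hp := hz p
      unfold TLBimod.rewire at hp
      grind
  · rintro ⟨hne, z', hne', hz', halt⟩ p
    have hp := halt p
    have ha := halt a
    have hb := halt b
    have e : z b = !z a := Bool.eq_not.2 hne.symm
    have e₁ : z a = !z b := by rw [e, Bool.not_not]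
    have e' : z' b = !z' a := Bool.eq_not.2 hne'.symm
    have e₁' : z' a = !z' b := by rw [e', Bool.not_not]
    unfold TLBimod.rewire
    grind

/-- An alternating colouring of a matching giving the same colour to two points of a row that are
not joined; the row is not monochromatic. -/
theorem exists_isAlternating {ι : Type*} {f : ι → P} {g : P → ℤ} (hg : Function.Injective g)
    (hrow : ∀ r u, g u < g (f r) → ∃ s, u = f s) (h : IsMatching σ) {p q r : ι}
    (hpq : σ (f p) ≠ f q) (hrp : f r ≠ f p) (hrq : f r ≠ f q) :
    ∃ z, IsAlternating σ z ∧ z (f p) = z (f q) ∧ ∃ s, z (f s) ≠ z (f p) := by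
  have h1 : ∀ p, σ (σ p) = p := fun p => (h p).1
  have h2 : ∀ p, σ p ≠ p := fun p => (h p).2
  let z : P → Bool := fun u => if u = f p ∨ u = f q then true else
    if σ u = f p ∨ σ u = f q then false else decide (g (σ u) < g u)
  have hz : ∀ u, z u = if u = f p ∨ u = f q then true else
    if σ u = f p ∨ σ u = f q then false else decide (g (σ u) < g u) := fun u => rfl
  have halt : IsAlternating σ z := by
    intro u
    have hu : g (σ u) ≠ g u := fun e => h2 u (hg e)
    rw [hz, hz, h1]
    by_cases e1 : u = f p ∨ u = f q
    · have : ¬ (σ u = f p ∨ σ u = f q) := by grind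
      simp [e1, this]
    · by_cases e2 : σ u = f p ∨ σ u = f q
      · simp [e1, e2]
      · simp only [e1, e2, if_false]
        rcases lt_or_gt_of_ne hu with h | h <;> simp [h, h.le]
  have hp : z (f p) = true := by rw [hz]; simp
  have hq : z (f q) = true := by rw [hz]; simp
  refine ⟨z, halt, hp.trans hq.symm, ?_⟩
  rw [hp]
  by_cases hr : z (f r) = true
  · have hlt : g (σ (f r)) < g (f r) := by
      rw [hz] at hr
      grind
    obtain ⟨s, hs⟩ := hrow r _ hlt
    refine ⟨s, ?_⟩
    rw [← hs, halt, hr]; simp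
  · exact ⟨r, hr⟩

end Matchings

/-! ## The matching of a word -/

section WordMatching

variable {n : ℕ}

/-- The positions of the top row, followed by those of the bottom row in reverse order. -/
def boundaryPos : Fin (n + 1) ⊕ Fin (n + 1) → ℕ :=
  Sum.elim (fun p => p.val) fun q => 2 * n + 1 - q.val

theorem boundaryPos_inl (p : Fin (n + 1)) : boundaryPos (.inl p) = p.val := rfl

theorem boundaryPos_inr (p : Fin (n + 1)) : boundaryPos (.inr p) = 2 * n + 1 - p.val := rfl

theorem boundaryPos_injective : Function.Injective (boundaryPos (n := n)) := by
  rintro (p | p) (q | q) h <;> simp only [boundaryPos_inl, boundaryPos_inr] at h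
  · rw [Fin.ext h]
  · omega
  · omega
  · rw [Fin.ext (show p.val = q.val by omega)]

/-- The Temperley–Lieb diagram of a word, as a matching of the top and bottom rows. -/
def wordMatching : List (Fin n) → Fin (n + 1) ⊕ Fin (n + 1) → Fin (n + 1) ⊕ Fin (n + 1)
  | [] => Sum.swap
  | i :: l => rewire (.inl i.castSucc) (.inl i.succ) (wordMatching l)

theorem inl_castSucc_ne_inl_succ (i : Fin n) :
    (Sum.inl i.castSucc : Fin (n + 1) ⊕ Fin (n + 1)) ≠ .inl i.succ :=
  fun h => Fin.castSucc_lt_succ.ne (Sum.inl.inj h)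

theorem isMatching_wordMatching (l : List (Fin n)) : IsMatching (wordMatching l) := by
  induction l with
  | nil => rintro (p | p) <;> simp [wordMatching]
  | cons i l ih => exact ih.rewire (inl_castSucc_ne_inl_succ i)

theorem isNoncrossing_wordMatching (l : List (Fin n)) :
    IsNoncrossing boundaryPos (wordMatching l) := by
  induction l with
  | nil =>
    rintro (p | p) (q | q) h h' <;>
      simp only [wordMatching, Sum.swap_inl, Sum.swap_inr, boundaryPos_inl, boundaryPos_inr]
        at h h' ⊢ <;> omega
  | cons i l ih =>
    exact IsNoncrossing.rewire boundaryPos_injective (isMatching_wordMatching l) ih rfl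

theorem colourStep_iff {i : Fin n} {c d : Fin (n + 1) → Bool} :
    colourStep i c d ↔ c i.castSucc ≠ c i.succ ∧ d i.castSucc ≠ d i.succ ∧
      ∀ p, p ≠ i.castSucc → p ≠ i.succ → d p = c p := by
  constructor
  · rintro ⟨h, rfl | rfl⟩
    · exact ⟨h, h, fun _ _ _ => rfl⟩
    · refine ⟨h, by simpa using h.symm, fun p hp hq => ?_⟩
      exact congrArg c (Equiv.swap_apply_of_ne_of_ne hp hq)
  · rintro ⟨h, h', hd⟩
    refine ⟨h, ?_⟩
    by_cases e : d i.castSucc = c i.castSucc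
    · left
      have e' : d i.succ = c i.succ := by
        cases h1 : d i.succ <;> cases h2 : c i.succ <;> simp_all
      ext p
      by_cases hp : p = i.castSucc
      · rw [hp, e]
      · by_cases hq : p = i.succ
        · rw [hq, e']
        · rw [hd p hp hq]
    · right
      have e1 : d i.castSucc = c i.succ := by
        cases h1 : d i.castSucc <;> cases h2 : c i.succ <;> simp_all
      have e2 : d i.succ = c i.castSucc := by
        cases h1 : d i.succ <;> cases h2 : c i.castSucc <;> simp_all
      ext p
      rw [Function.comp_apply]
      by_cases hp : p = i.castSucc
      · rw [hp, e1, simpleRefl_castSucc]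
      · by_cases hq : p = i.succ
        · rw [hq, e2, simpleRefl_succ]
        · rw [hd p hp hq, simpleRefl, Equiv.swap_apply_of_ne_of_ne hp hq]

/-- The colouring of both rows, with the colours of the bottom row exchanged. -/
def rowColouring (c c' : Fin (n + 1) → Bool) : Fin (n + 1) ⊕ Fin (n + 1) → Bool :=
  Sum.elim c fun q => !c' q

/-- Arcs within a row join different colours and through strands join equal ones. Negating the
bottom row turns both into the same alternation rule. -/
theorem colourRel_iff {l : List (Fin n)} {c c' : Fin (n + 1) → Bool} :
    colourRel l c c' ↔ IsAlternating (wordMatching l) (rowColouring c c') := by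
  induction l generalizing c with
  | nil =>
    constructor
    · rintro rfl (p | p) <;> simp [wordMatching, rowColouring]
    · intro h
      change c = c'
      ext p
      have := h (.inl p)
      simpa [wordMatching, rowColouring] using this.symm
  | cons i l ih =>
    change Relation.Comp (colourStep i) (colourRel l) c c' ↔ _
    rw [wordMatching, isAlternating_rewire_iff (isMatching_wordMatching l)
      (inl_castSucc_ne_inl_succ i)]
    constructor
    · rintro ⟨d, h1, h2⟩
      obtain ⟨e1, e2, e3⟩ := colourStep_iff.1 h1
      refine ⟨e1, rowColouring d c', e2, ?_, ih.1 h2⟩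
      rintro (p | p) hp hq
      · exact e3 p (fun h => hp (by rw [h])) (fun h => hq (by rw [h]))
      · rfl
    · rintro ⟨e1, z', e2, e3, e4⟩
      refine ⟨fun p => z' (.inl p), colourStep_iff.2 ⟨e1, e2, fun p hp hq => ?_⟩, ih.2 ?_⟩
      · exact e3 _ (fun h => hp (Sum.inl.inj h)) fun h => hq (Sum.inl.inj h)
      · have : rowColouring (fun p => z' (.inl p)) c' = z' := by
          ext (p | p)
          · rfl
          · exact (e3 (.inr p) (by simp) (by simp)).symm
        rwa [this]

theorem exists_third (hn : 2 ≤ n) (p q : Fin (n + 1)) : ∃ r, r ≠ p ∧ r ≠ q := by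
  have : ∃ r ∈ (Finset.univ : Finset (Fin (n + 1))), r ∉ ({p, q} : Finset (Fin (n + 1))) :=
    Finset.exists_mem_notMem_of_card_lt_card
      (lt_of_le_of_lt Finset.card_le_two (by rw [Finset.card_univ, Fintype.card_fin]; omega))
  obtain ⟨r, -, hr⟩ := this
  simp only [Finset.mem_insert, Finset.mem_singleton, not_or] at hr
  exact ⟨r, hr⟩

theorem eq_inl_iff_colours (hn : 2 ≤ n) (l : List (Fin n)) (p q : Fin (n + 1)) :
    wordMatching l (.inl p) = .inl q ↔ ∀ c, (∃ a b, c a ≠ c b) → (∃ c', colourRel l c c') →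
      c p ≠ c q := by
  constructor
  · rintro h c - ⟨c', hc⟩
    have := colourRel_iff.1 hc (.inl p)
    rw [h] at this
    change c q = !c p at this
    rw [this]; simp
  · intro h
    by_contra hne
    obtain ⟨r, hr, hr'⟩ := exists_third hn p q
    obtain ⟨z, hz, e, s, hs⟩ := exists_isAlternating (f := Sum.inl)
      -- The top row comes first in boundary order; the bottom row is treated below with the
      -- opposite sign.
      (g := fun u => (boundaryPos u : ℤ))
      (fun _ _ e => boundaryPos_injective (Int.ofNat.inj e))
      (fun r u hu => by
        rcases u with u | u
        · exact ⟨u, rfl⟩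
        · simp only [boundaryPos_inl, boundaryPos_inr] at hu
          omega)
      (isMatching_wordMatching l) hne (fun e => hr (Sum.inl.inj e)) (fun e => hr' (Sum.inl.inj e))
    refine h (fun p => z (.inl p)) ⟨s, p, hs⟩ ⟨fun q => !z (.inr q), colourRel_iff.2 ?_⟩ e
    convert hz using 1
    ext (u | u) <;> simp [rowColouring]

theorem eq_inr_iff_colours (hn : 2 ≤ n) (l : List (Fin n)) (p q : Fin (n + 1)) :
    wordMatching l (.inr p) = .inr q ↔ ∀ c', (∃ a b, c' a ≠ c' b) → (∃ c, colourRel l c c') →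
      c' p ≠ c' q := by
  constructor
  · rintro h c' - ⟨c, hc⟩
    have := colourRel_iff.1 hc (.inr p)
    rw [h] at this
    change (!c' q) = !!c' p at this
    intro e
    simp [e] at this
  · intro h
    by_contra hne
    obtain ⟨r, hr, hr'⟩ := exists_third hn p q
    obtain ⟨z, hz, e, s, hs⟩ := exists_isAlternating (f := Sum.inr)
      (g := fun u => -(boundaryPos u : ℤ))
      (fun _ _ e => boundaryPos_injective (Int.ofNat.inj (neg_injective e)))
      (fun r u hu => by
        rcases u with u | u
        · simp only [boundaryPos_inl, boundaryPos_inr] at hu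
          omega
        · exact ⟨u, rfl⟩)
      (isMatching_wordMatching l) hne (fun e => hr (Sum.inr.inj e)) (fun e => hr' (Sum.inr.inj e))
    refine h (fun q => !z (.inr q)) ⟨s, p, fun e => hs (by simpa using e)⟩
      ⟨fun p => z (.inl p), colourRel_iff.2 ?_⟩ (congrArg (!·) e)
    convert hz using 1
    ext (u | u) <;> simp [rowColouring]

/-- A noncrossing matching of two rows is determined by its arcs within each row. -/
theorem IsNoncrossing.eq_of_rows {σ τ : Fin (n + 1) ⊕ Fin (n + 1) → Fin (n + 1) ⊕ Fin (n + 1)}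
    (hσ : IsMatching σ) (hτ : IsMatching τ) (nσ : IsNoncrossing boundaryPos σ)
    (nτ : IsNoncrossing boundaryPos τ)
    (htop : ∀ p q, σ (.inl p) = .inl q ↔ τ (.inl p) = .inl q)
    (hbot : ∀ p q, σ (.inr p) = .inr q ↔ τ (.inr p) = .inr q) : σ = τ := by
  have key : ∀ (σ τ : Fin (n + 1) ⊕ Fin (n + 1) → Fin (n + 1) ⊕ Fin (n + 1)),
      IsMatching σ → IsMatching τ → IsNoncrossing boundaryPos τ →
      (∀ p q, σ (.inl p) = .inl q ↔ τ (.inl p) = .inl q) →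
      (∀ p q, σ (.inr p) = .inr q ↔ τ (.inr p) = .inr q) →
      ∀ p, (∀ q < p, σ (.inl q) = τ (.inl q)) → ∀ a b, σ (.inl p) = .inr a → τ (.inl p) = .inr b →
      b ≤ a := by
    intro σ τ hσ hτ nτ htop hbot p hp a b ha hb
    -- At the first through strand where the matchings could differ, the `τ`-partner `q` of `a` is
    -- on top, since bottom arcs agree. It is not left of `p`, by agreement there, and if it is
    -- right of `p`, noncrossing gives `b < a`.
    rcases hc : τ (.inr a) with q | q
    · have hτq : τ (.inl q) = .inr a := by rw [← hc, (hτ _).1]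
      rcases lt_trichotomy q p with hlt | rfl | hlt
      · have h1 := hp q hlt
        rw [hτq, ← ha] at h1
        have := congrArg σ h1
        rw [(hσ _).1, (hσ _).1] at this
        exact absurd (Sum.inl.inj this) hlt.ne
      · rw [hτq] at hb
        exact (Sum.inr.inj hb).ge
      · have := nτ (.inl p) (.inl q) hlt (by
          rw [hb, boundaryPos_inl, boundaryPos_inr]; omega)
        rw [hb, hτq] at this
        have := this.2
        rw [boundaryPos_inr, boundaryPos_inr] at this
        rw [Fin.le_def]
        omega
    · have := (hbot a q).2 hc
      rw [← ha, (hσ _).1] at this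
      exact absurd this (by simp)
  have top : ∀ p, σ (.inl p) = τ (.inl p) := by
    intro p
    induction p using WellFoundedLT.induction with
    | ind p ih =>
      rcases h1 : σ (.inl p) with a | a
      · exact ((htop p a).1 h1).symm
      · rcases h2 : τ (.inl p) with b | b
        · rw [(htop p b).2 h2] at h1
          exact absurd h1 (by simp)
        · have e1 := key σ τ hσ hτ nτ htop hbot p ih a b h1 h2
          have e2 := key τ σ hτ hσ nσ (fun p q => (htop p q).symm) (fun p q => (hbot p q).symm) p
            (fun q hq => (ih q hq).symm) b a h2 h1
          rw [le_antisymm e1 e2]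
  funext u
  rcases u with p | p
  · exact top p
  · rcases h1 : σ (.inr p) with a | a
    · have h2 : σ (.inl a) = .inr p := by rw [← h1, (hσ _).1]
      rw [top a] at h2
      rw [← h2, (hτ _).1]
    · exact ((hbot p a).1 h1).symm

theorem colourRel_eq_of_rows (hn : 2 ≤ n) {l l' : List (Fin n)}
    (hdom : ∀ c, (∃ a b, c a ≠ c b) → ((∃ c', colourRel l c c') ↔ ∃ c', colourRel l' c c'))
    (hran : ∀ c', (∃ a b, c' a ≠ c' b) → ((∃ c, colourRel l c c') ↔ ∃ c, colourRel l' c c'))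
    (c c' : Fin (n + 1) → Bool) : colourRel l c c' ↔ colourRel l' c c' := by
  have : wordMatching l = wordMatching l' := by
    refine IsNoncrossing.eq_of_rows (isMatching_wordMatching l) (isMatching_wordMatching l')
      (isNoncrossing_wordMatching l) (isNoncrossing_wordMatching l') (fun p q => ?_) fun p q => ?_
    · rw [eq_inl_iff_colours hn, eq_inl_iff_colours hn]
      exact forall₂_congr fun c hc => by rw [hdom c hc]
    · rw [eq_inr_iff_colours hn, eq_inr_iff_colours hn]
      exact forall₂_congr fun c hc => by rw [hran c hc]
  rw [colourRel_iff, colourRel_iff, this]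

end WordMatching

/-! ## From points to colourings -/

section Comparison

variable {k : Type*} [Field k] [CharZero k] {n : ℕ}

theorem stepRel_colourVec_iff {i : Fin n} {c : Fin (n + 1) → Bool} {a b : Fin (n + 1)}
    (h : c a ≠ c b) (y : weylUnion k n) :
    stepRel k i ⟨_, colourVec_mem_weylUnion h⟩ y ↔ ∃ c', colourStep i c c' ∧ y.1 = colourVec k c' := by
  rw [stepRel, colourVec_mem_transverseUnion h, act_colourVec, simpleRefl_inv]
  constructor
  · rintro ⟨hi, hy | hy⟩
    · exact ⟨c, ⟨hi, .inl rfl⟩, hy⟩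
    · exact ⟨_, ⟨hi, .inr rfl⟩, hy⟩
  · rintro ⟨c', ⟨hi, rfl | rfl⟩, hy⟩
    · exact ⟨hi, .inl hy⟩
    · exact ⟨hi, .inr hy⟩

theorem colourStep.ne {i : Fin n} {c c' : Fin (n + 1) → Bool} (h : colourStep i c c') :
    c' i.castSucc ≠ c' i.succ := (colourStep_iff.1 h).2.1

theorem wordRel_colourVec_iff {l : List (Fin n)} {c : Fin (n + 1) → Bool} {a b : Fin (n + 1)}
    (h : c a ≠ c b) (y : weylUnion k n) :
    wordRel k l ⟨_, colourVec_mem_weylUnion h⟩ y ↔ ∃ c', colourRel l c c' ∧ y.1 = colourVec k c' := by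
  induction l generalizing c a b with
  | nil =>
    constructor
    · rintro rfl
      exact ⟨c, rfl, rfl⟩
    · rintro ⟨_, rfl, hy⟩
      exact Subtype.ext hy.symm
  | cons i l ih =>
    constructor
    · rintro ⟨x, hx, hxy⟩
      obtain ⟨d, hd, e⟩ := (stepRel_colourVec_iff h x).1 hx
      obtain ⟨x, hx'⟩ := x
      subst e
      obtain ⟨c', hc', e'⟩ := (ih hd.ne).1 hxy
      exact ⟨c', ⟨d, hd, hc'⟩, e'⟩
    · rintro ⟨c', ⟨d, hd, hc'⟩, e⟩
      exact ⟨_, (stepRel_colourVec_iff h _).2 ⟨d, hd, rfl⟩, (ih hd.ne).2 ⟨c', hc', e⟩⟩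

theorem colourRel.nonconstant {l : List (Fin n)} {c c' : Fin (n + 1) → Bool}
    (h : colourRel l c c') : (∃ a b, c a ≠ c b) ↔ ∃ a b, c' a ≠ c' b := by
  induction l generalizing c with
  | nil => cases h; rfl
  | cons i l ih =>
    obtain ⟨d, h1, h2⟩ := h
    rw [← ih h2]
    exact ⟨fun _ => ⟨_, _, h1.ne⟩, fun _ => ⟨_, _, h1.1⟩⟩

theorem wordRel_colourVec_colourVec_iff {l : List (Fin n)} {c c' : Fin (n + 1) → Bool}
    {a b a' b' : Fin (n + 1)} (h : c a ≠ c b) (h' : c' a' ≠ c' b') :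
    wordRel k l ⟨_, colourVec_mem_weylUnion h⟩ ⟨_, colourVec_mem_weylUnion h'⟩ ↔
      colourRel l c c' := by
  rw [wordRel_colourVec_iff h]
  constructor
  · rintro ⟨d, hd, e⟩
    rwa [colourVec_injective h' e]
  · exact fun hc => ⟨c', hc, rfl⟩

/-- Each letter moves a point at most by `s_i`, which permutes colouring vectors, so going backwards
also stays among them. -/
theorem exists_eq_colourVec_of_wordRel {l : List (Fin n)} {c' : Fin (n + 1) → Bool}
    {a b : Fin (n + 1)} (h : c' a ≠ c' b) {x : weylUnion k n}
    (hx : wordRel k l x ⟨_, colourVec_mem_weylUnion h⟩) :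
    ∃ c, (∃ p q, c p ≠ c q) ∧ x.1 = colourVec k c := by
  induction l generalizing x with
  | nil =>
    rw [wordRel] at hx
    subst hx
    exact ⟨c', ⟨a, b, h⟩, rfl⟩
  | cons i l ih =>
    obtain ⟨y, ⟨-, hxy⟩, hy⟩ := hx
    obtain ⟨c, hc, e⟩ := ih hy
    rcases hxy with hxy | hxy
    · exact ⟨c, hc, hxy.symm.trans e⟩
    · obtain ⟨p, q, hpq⟩ := hc
      refine ⟨c ∘ simpleRefl i, ⟨simpleRefl i p, simpleRefl i q, by simpa using hpq⟩, ?_⟩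
      rw [← act_simpleRefl_self i x.1, ← hxy, e, act_colourVec, simpleRefl_inv]

theorem exists_wordRel_left_iff {l : List (Fin n)} {c : Fin (n + 1) → Bool} {a b : Fin (n + 1)}
    (h : c a ≠ c b) :
    (∃ y, wordRel k l ⟨_, colourVec_mem_weylUnion h⟩ y) ↔ ∃ c', colourRel l c c' := by
  constructor
  · rintro ⟨y, hy⟩
    obtain ⟨c', hc', -⟩ := (wordRel_colourVec_iff h y).1 hy
    exact ⟨c', hc'⟩
  · rintro ⟨c', hc'⟩
    obtain ⟨a', b', h'⟩ := hc'.nonconstant.1 ⟨a, b, h⟩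
    exact ⟨_, (wordRel_colourVec_colourVec_iff h h').2 hc'⟩

theorem exists_wordRel_right_iff {l : List (Fin n)} {c' : Fin (n + 1) → Bool} {a b : Fin (n + 1)}
    (h : c' a ≠ c' b) :
    (∃ x, wordRel k l x ⟨_, colourVec_mem_weylUnion h⟩) ↔ ∃ c, colourRel l c c' := by
  constructor
  · rintro ⟨x, hx⟩
    obtain ⟨c, ⟨p, q, hc⟩, e⟩ := exists_eq_colourVec_of_wordRel h hx
    obtain ⟨x, hx'⟩ := x
    subst e
    exact ⟨c, (wordRel_colourVec_colourVec_iff hc h).1 hx⟩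
  · rintro ⟨c, hc⟩
    obtain ⟨a', b', h'⟩ := hc.nonconstant.2 ⟨a, b, h⟩
    exact ⟨_, (wordRel_colourVec_colourVec_iff h' h).2 hc⟩

theorem IsFullyCommutative.eq_of_iso {w w' : Equiv.Perm (Fin (n + 1))} {l l' : List (Fin n)}
    (hw : IsFullyCommutative w) (hw' : IsFullyCommutative w') (hl : IsReducedExpr l w)
    (hl' : IsReducedExpr l' w') (e : (wordBimod k n l).Iso (wordBimod k n l')) : w = w' := by
  have hrel : ∀ x y, wordRel k l x y ↔ wordRel k l' x y :=
    (controlled_wordBimod l).rel_iff_of_iso (controlled_wordBimod l') evalAt_separates e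
  refine hw.eq_of_colourRel hw' hl hl' fun c c' hc => ?_
  have key : ∀ l l' : List (Fin n), (∀ x y, wordRel k l x y ↔ wordRel k l' x y) →
      colourRel l c c' → colourRel l' c c' := by
    intro l l' hrel h
    obtain ⟨a', b', h'⟩ := h.nonconstant.1 hc
    obtain ⟨a, b, hc⟩ := hc
    rwa [← wordRel_colourVec_colourVec_iff (k := k) hc h', ← hrel,
      wordRel_colourVec_colourVec_iff hc h']
  exact ⟨key l l' hrel, key l' l fun x y => (hrel x y).symm⟩

theorem IsFullyCommutative.eq_of_varieties (hn : 2 ≤ n) {w w' : Equiv.Perm (Fin (n + 1))}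
    {l l' : List (Fin n)} (hw : IsFullyCommutative w) (hw' : IsFullyCommutative w')
    (hl : IsReducedExpr l w) (hl' : IsReducedExpr l' w')
    (hleft : leftVariety (wordBimod k n l) = leftVariety (wordBimod k n l'))
    (hright : rightVariety (wordBimod k n l) = rightVariety (wordBimod k n l')) : w = w' := by
  refine hw.eq_of_colourRel hw' hl hl' fun c c' _ => colourRel_eq_of_rows hn ?_ ?_ c c'
  · rintro c ⟨a, b, h⟩
    rw [← exists_wordRel_left_iff (k := k) h, ← exists_wordRel_left_iff (k := k) h,
      ← mem_leftVariety_iff (controlled_wordBimod l),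
      ← mem_leftVariety_iff (controlled_wordBimod l'), hleft]
  · rintro c ⟨a, b, h⟩
    rw [← exists_wordRel_right_iff (k := k) h, ← exists_wordRel_right_iff (k := k) h,
      ← mem_rightVariety_iff (controlled_wordBimod l),
      ← mem_rightVariety_iff (controlled_wordBimod l'), hright]

end Comparison

theorem leftVariety_eq_of_iso {k : Type*} [Field k] {n : ℕ} {B B' : Bimod (Rbar k n) (Rbar k n)}
    (e : B.Iso B') : leftVariety B = leftVariety B' := by
  rw [leftVariety, e.leftAnn_eq, leftVariety]

theorem rightVariety_eq_of_iso {k : Type*} [Field k] {n : ℕ} {B B' : Bimod (Rbar k n) (Rbar k n)}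
    (e : B.Iso B') : rightVariety B = rightVariety B' := by
  rw [rightVariety, e.rightAnn_eq, rightVariety]

end TLBimod

theorem mainTheorem8 (k : Type*) [Field k] [CharZero k] (n : ℕ)
    (w w' : Equiv.Perm (Fin (n + 1)))
    (hw : TLBimod.IsFullyCommutative w) (hw' : TLBimod.IsFullyCommutative w') (hne : w ≠ w')
    (B B' : TLBimod.Bimod (TLBimod.Rbar k n) (TLBimod.Rbar k n))
    (hB : TLBimod.IsBimodOf w B) (hB' : TLBimod.IsBimodOf w' B') :
    IsEmpty (B.Iso B') ∧
      (2 ≤ n → (TLBimod.leftVariety B, TLBimod.rightVariety B) ≠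
        (TLBimod.leftVariety B', TLBimod.rightVariety B')) := by
  obtain ⟨l, hl, ⟨e⟩⟩ := hB
  obtain ⟨l', hl', ⟨e'⟩⟩ := hB'
  refine ⟨⟨fun f => hne (hw.eq_of_iso hw' hl hl' (e.symm.trans (f.trans e')))⟩, fun hn h => ?_⟩
  rw [Prod.mk.injEq, TLBimod.leftVariety_eq_of_iso e, TLBimod.leftVariety_eq_of_iso e',
    TLBimod.rightVariety_eq_of_iso e, TLBimod.rightVariety_eq_of_iso e'] at h
  exact hne (hw.eq_of_varieties hn hw' hl hl' h.1 h.2)
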